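/- Let $J\ge 0$, $K\ge 1$, let $(X,Y)$ be a random vector in $\mathbb{R}^J\times\mathbb{R}^K$, let $\rho_Y$ be the law of $Y$ and $\rho(X\mid Y=y)$ the regular conditional law of $X$ given $Y=y$ (defined for $\rho_Y$-almost every $y$), and let $f:\mathbb{R}^J\to\mathbb{R}$. The nested expectation is $I=\mathbb{E}_Y\, f(\mathbb{E}[X\mid Y])$. The variance of a random vector means the trace of its covariance matrix, $\|\cdot\|_2$ is the Euclidean norm, and $\mathbf u{:}p$ denotes the word $\mathbf u$ with the letter $p$ appended. **Estimator.** Let $m\ge 1$ be an integer, $N=2^m$, and let $(X^{(i)},Y^{(i)})$, $1\le i\le N$, be i.i.d. copies of $(X,Y)$. Let $t^{(1)},\dots,t^{(N)}$ be i.i.d. real random variables, independent of these samples, such that almost surely, for all $i\ne j$ and all $k$, $Y^{(i)}_k\ne Y^{(j)}_k$ or $t^{(i)}\neq t^{(j)}$. (Marks $t^{(i)}$ uniform on $[0,1]$ always have this property; if every $Y_k$ has a continuous distribution then constant marks have it, and the marks play no role.) Put $B^0_\emptyset=\{1,\dots,N\}$. For $d=1,\dots,m$ and $\mathbf u\in\{0,1\}^{d-1}$,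 the set $B^{d-1}_{\mathbf u}$ is partitioned into two sets of equal size $2^{m-d}$ in two ways: as $B^{d}_{\mathbf u:0}\cup B^{d}_{\mathbf u:1}$, such that with $k=((d-1)\bmod K)+1$ all $i_0\in B^{d}_{\mathbf u:0}$ and $i_1\in B^{d}_{\mathbf u:1}$ satisfy $Y^{(i_0)}_k<Y^{(i_1)}_k$, or $Y^{(i_0)}_k=Y^{(i_1)}_k$ and $t^{(i_0)}\le t^{(i_1)}$; and as $B'^{d}_{\mathbf u:0}\cup B'^{d}_{\mathbf u:1}$, such that $i_0\le i_1$ for all $i_0\in B'^{d}_{\mathbf u:0}$ and $i_1\in B'^{d}_{\mathbf u:1}$. Define $$\hat I=\sum_{d=0}^{m}\frac1{2^d}\sum_{\mathbf u\in\{0,1\}^d} f\Big(\frac1{2^{m-d}}\sum_{i\in B^d_{\mathbf u}}X^{(i)}\Big)-\sum_{d=1}^{m}\frac1{2^d}\sum_{\mathbf u\in\{0,1\}^d} f\Big(\frac1{2^{m-d}}\sum_{i\in B'^d_{\mathbf u}}X^{(i)}\Big).$$ **Assumptions.** The conditional variance of $X$ given $Y=y$ is bounded uniformly over $\rho_Y$-almost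 every $y$. There are constants $\alpha_1,\alpha_2>0$ such that for all $x,y,y'\in\mathbb{R}^J$ 1. $|f(x)-f(x+y)|\le\alpha_1\|y\|_2$, and 2. $|f(x)-f(x+y)-f(x+y')+f(x+y+y')|\le\alpha_2\|y\|_2\|y'\|_2$. There are a constant $\beta>0$ and nondecreasing functions $\mathcal T_k:\mathbb{R}\to[0,1]$, $k=1,\dots,K$, such that, writing $\mathcal T(y)=(\mathcal T_1(y_1),\dots,\mathcal T_K(y_K))$, for almost every pair $(y_1,y_2)$ with respect to $\rho_Y\otimes\rho_Y$ there is a coupling $(X_1,X_2)$ with 3. $X_1\sim\rho(X\mid Y=y_1)$, $X_2\sim\rho(X\mid Y=y_2)$, and 4. $\|X_1-X_2\|_2\le\beta\,\|\mathcal T(y_1)-\mathcal T(y_2)\|_2$ almost surely. **Conclusion.** Then $$\mathbb{E}(I-\hat I)^2=O\Big(\frac{(\log N)^2}{N^{1/K}}\Big),$$ that is, there is a constant $C$, not depending on $m$ (nor on the probability space or the law of the marks), such that $\mathbb{E}(I-\hat I)^2\le C(\log N)^2/N^{1/K}$ for every $m\ge 1$ and $N=2^m$. -/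

import Mathlib

open MeasureTheory ProbabilityTheory
open scoped ENNReal NNReal

namespace NestedExpectation

/-- The regular conditional distribution `ρ(X | Y = y)` of the first component given the second one,
for the joint law `ρ` of `(X, Y)`. -/
noncomputable def condLaw {J K : ℕ}
    (ρ : Measure (EuclideanSpace ℝ (Fin J) × EuclideanSpace ℝ (Fin K))) [IsFiniteMeasure ρ] :
    Kernel (EuclideanSpace ℝ (Fin K)) (EuclideanSpace ℝ (Fin J)) :=
  condDistrib Prod.fst Prod.snd ρ

/-- The inner conditional expectation `𝔼[X | Y = y]`. -/
noncomputable def condMean {J K : ℕ}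
    (ρ : Measure (EuclideanSpace ℝ (Fin J) × EuclideanSpace ℝ (Fin K))) [IsFiniteMeasure ρ]
    (y : EuclideanSpace ℝ (Fin K)) : EuclideanSpace ℝ (Fin J) :=
  ∫ x, x ∂(condLaw ρ y)

/-- The conditional variance of `X` given `Y = y` (trace of the conditional covariance matrix),
with values in `[0, ∞]`. It is infinite when the conditional law has no second moment. -/
noncomputable def condVar {J K : ℕ}
    (ρ : Measure (EuclideanSpace ℝ (Fin J) × EuclideanSpace ℝ (Fin K))) [IsFiniteMeasure ρ]
    (y : EuclideanSpace ℝ (Fin K)) : ℝ≥0∞ :=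
  ∫⁻ x, ‖x - condMean ρ y‖ₑ ^ 2 ∂(condLaw ρ y)

/-- The nested expectation `I = 𝔼_Y f(𝔼[X | Y])`. -/
noncomputable def nestedExp {J K : ℕ}
    (ρ : Measure (EuclideanSpace ℝ (Fin J) × EuclideanSpace ℝ (Fin K))) [IsFiniteMeasure ρ]
    (f : EuclideanSpace ℝ (Fin J) → ℝ) : ℝ :=
  ∫ y, f (condMean ρ y) ∂ρ.snd

/-- The coordinatewise map `𝒯(y) = (𝒯₁(y₁), …, 𝒯_K(y_K))`. -/
noncomputable def coordMap {K : ℕ} (T : Fin K → ℝ → ℝ) (y : EuclideanSpace ℝ (Fin K)) :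
    EuclideanSpace ℝ (Fin K) :=
  WithLp.toLp 2 fun k => T k (y k)

/-- `u:p`, the word `u ∈ {0,1}^d` with the letter `p` appended (`false` is `0`, `true` is `1`). -/
def append {d : ℕ} (u : Fin d → Bool) (p : Bool) : Fin (d + 1) → Bool :=
  Fin.snoc (α := fun _ => Bool) u p

/-- `B` and `B'` are families of index sets produced by the recursive halving algorithm from the
outer samples `y`, with ties in the sorting step resolved by the marks `t`: a block `B d u` is cut
into two halves of equal size once by sorting along the coordinate `d mod K` (coordinates are
numbered from `0`), which gives `B (d + 1) (u:0)` and `B (d + 1) (u:1)`, and once by the index,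
which gives `B' (d + 1) (u:0)` and `B' (d + 1) (u:1)`. -/
structure IsHalving {K : ℕ} [NeZero K] (m : ℕ) (y : Fin (2 ^ m) → EuclideanSpace ℝ (Fin K))
    (t : Fin (2 ^ m) → ℝ) (B B' : (d : ℕ) → (Fin d → Bool) → Finset (Fin (2 ^ m))) : Prop where
  root : ∀ u, B 0 u = Finset.univ
  union : ∀ d < m, ∀ u : Fin d → Bool,
    B (d + 1) (append u false) ∪ B (d + 1) (append u true) = B d u
  union' : ∀ d < m, ∀ u : Fin d → Bool,
    B' (d + 1) (append u false) ∪ B' (d + 1) (append u true) = B d u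
  disjoint : ∀ d < m, ∀ u : Fin d → Bool,
    Disjoint (B (d + 1) (append u false)) (B (d + 1) (append u true))
  disjoint' : ∀ d < m, ∀ u : Fin d → Bool,
    Disjoint (B' (d + 1) (append u false)) (B' (d + 1) (append u true))
  card : ∀ d < m, ∀ (u : Fin d → Bool) (p : Bool),
    (B (d + 1) (append u p)).card = 2 ^ (m - (d + 1))
  card' : ∀ d < m, ∀ (u : Fin d → Bool) (p : Bool),
    (B' (d + 1) (append u p)).card = 2 ^ (m - (d + 1))
  sorted : ∀ d < m, ∀ u : Fin d → Bool,
    ∀ i₀ ∈ B (d + 1) (append u false), ∀ i₁ ∈ B (d + 1) (append u true),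
      y i₀ (Fin.ofNat K d) < y i₁ (Fin.ofNat K d) ∨
        (y i₀ (Fin.ofNat K d) = y i₁ (Fin.ofNat K d) ∧ t i₀ ≤ t i₁)
  sorted' : ∀ d < m, ∀ u : Fin d → Bool,
    ∀ i₀ ∈ B' (d + 1) (append u false), ∀ i₁ ∈ B' (d + 1) (append u true), i₀ ≤ i₁

/-- The average of `f(mean of X over the block)` over the `2^d` blocks of level `d`. -/
noncomputable def levelAverage {J : ℕ} (m : ℕ) (f : EuclideanSpace ℝ (Fin J) → ℝ)
    (x : Fin (2 ^ m) → EuclideanSpace ℝ (Fin J))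
    (B : (d : ℕ) → (Fin d → Bool) → Finset (Fin (2 ^ m))) (d : ℕ) : ℝ :=
  (1 / 2 ^ d : ℝ) * ∑ u : Fin d → Bool, f ((1 / 2 ^ (m - d) : ℝ) • ∑ i ∈ B d u, x i)

/-- The estimator `Î`. -/
noncomputable def estimator {J : ℕ} (m : ℕ) (f : EuclideanSpace ℝ (Fin J) → ℝ)
    (x : Fin (2 ^ m) → EuclideanSpace ℝ (Fin J))
    (B B' : (d : ℕ) → (Fin d → Bool) → Finset (Fin (2 ^ m))) : ℝ :=
  ∑ d ∈ Finset.range (m + 1), levelAverage m f x B d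
    - ∑ d ∈ Finset.Icc 1 m, levelAverage m f x B' d

end NestedExpectation

/-! Pairing the average over the sorted blocks of level d with the average over their index halves
turns the estimator into the plain mean of the f(X_i) plus averaged antithetic differences f(mean
over S) − f(mean over A)/2 − f(mean over B)/2, where A and B are the index halves of a block S
(`IsHalving.estimator_eq`). Given the outer samples and marks, the blocks are fixed and the inner
samples are independent with laws κ_i, so the conditional mean squared error is a variance plus a
squared bias.

Variance. Each sample lies in one block per level, so the estimator is Lipschitz in each X_i with
constant of order m/N. Tensorization (`variance_pi_le`) gives O(m²/N).

Bias. If all samples of a block had one law κ_i, the mean antithetic difference would depend only on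
the block size. Summed over the levels it would telescope and replace ∫ f dκ_i by the mean of f at
the average of N independent samples of law κ_i, which is within O(N^(-1/2)) of f(𝔼[X | Y_i]);
averaging the latter over i is ordinary Monte Carlo. What remains is the cost of replacing the laws
in a block by a common one (`levelBias`). Let h and k be half the difference of the two half means
for the true and for the common laws, coupled within distance δ, which is β times the diameter of
the block after 𝒯. The second-difference hypothesis bounds the change of the antithetic difference
by a multiple of δ‖k‖ + ‖h − k‖² (`antithetic_sub_le`). Here k has second moment O(1/|S|), and h − k
has second moment at most δ²/|S| + e², where e is the norm of half the difference between the
averages of the conditional means over A and B.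

For fixed outer samples e need not be small. But the split by index ignores Y: the law of the outer
samples restricted to the event that a given block equals S is invariant under exchanges inside S.
Differences between paired members of A and B are therefore orthogonal in mean, and e² also averages
to O(δ²/|S|) (`IsSplit.setLIntegral_sum_weight_le`).

Geometry. A split along coordinate k cuts an interval of 𝒯_k-values in two without increasing the
total length, so the mean squared diameter at level d is at most K·2^(-⌊d/K⌋)
(`IsHalving.exists_diam`). The mean squared bias of level d is thus O(2^(-d/K)·2^(-(m-d))), hence
O(N^(-1/K)), and Cauchy–Schwarz over the m levels produces the factor m², that is (log N)². -/

namespace NestedExpectation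

/-! ### Second differences and variance on product spaces -/

/-- The antithetic difference `f(a) - (f(a + h) + f(a - h)) / 2` is stable under perturbations of
its base point and of its increment. -/
lemma antithetic_sub_le {E : Type*} [NormedAddCommGroup E] [NormedSpace ℝ E] {f : E → ℝ} {α : ℝ}
    (hf : ∀ x y y', |f x - f (x + y) - f (x + y') + f (x + y + y')| ≤ α * ‖y‖ * ‖y'‖)
    (hα : 0 ≤ α) (a h b k : E) :
    |(f a - f (a + h) / 2 - f (a - h) / 2) - (f b - f (b + k) / 2 - f (b - k) / 2)|
      ≤ α * (‖a - b‖ * ‖k‖ + ‖h - k‖ * ‖k‖ + ‖h - k‖ ^ 2 / 2) := by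
  -- `h1` and `h2` move the base point from b to a with increments ±k. `h3` compares the increments
  -- h and k at a, through the parallelogram a − h, a − k, a + k, a + h.
  have h1 := hf b (a - b) k
  have h2 := hf b (a - b) (-k)
  have h3 := hf (a - h) (h - k) (k + h)
  have e1 : b + (a - b) = a := by abel
  have e2 : a - h + (h - k) = a - k := by abel
  have e3 : a - h + (k + h) = a + k := by abel
  have e4 : a - k + (k + h) = a + h := by abel
  rw [e1] at h1 h2
  rw [e2, e3, e4] at h3
  rw [norm_neg] at h2
  simp only [← sub_eq_add_neg] at h2
  have h4 : ‖k + h‖ ≤ 2 * ‖k‖ + ‖h - k‖ := by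
    have : k + h = k + k + (h - k) := by abel
    rw [this]
    refine (norm_add_le _ _).trans ?_
    have := norm_add_le k k
    linarith
  have h5 : α * ‖h - k‖ * ‖k + h‖ ≤ α * ‖h - k‖ * (2 * ‖k‖ + ‖h - k‖) := by gcongr
  rw [abs_le] at *
  constructor <;> nlinarith

lemma measurePreserving_eval_pair {ι : Type*} [Fintype ι] {Ω : ι → Type*}
    [∀ i, MeasurableSpace (Ω i)] (μ : ∀ i, Measure (Ω i)) [∀ i, IsProbabilityMeasure (μ i)]
    {i j : ι} (hij : i ≠ j) :
    MeasurePreserving (fun x : ∀ i, Ω i => (x i, x j)) (Measure.pi μ) ((μ i).prod (μ j)) := by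
  refine ⟨by fun_prop, ?_⟩
  have h := (iIndepFun_pi (μ := μ) (X := fun i (x : Ω i) => x)
    (fun i => aemeasurable_id)).indepFun hij
  rw [indepFun_iff_map_prod_eq_prod_map_map (measurable_pi_apply i).aemeasurable
    (measurable_pi_apply j).aemeasurable] at h
  rw [h, (measurePreserving_eval μ i).map_eq, (measurePreserving_eval μ j).map_eq]

/-- By independence the off-diagonal inner products factor into products of means. The diagonal
keeps uncentred second moments, so the squares of the individual means on the right are surplus. The
variables need not be centred, which is what lets the discrepancy of conditional means appear as a
separate term. -/
lemma integral_norm_sq_sum_pi_le {ι : Type*} [Fintype ι] {Ω : ι → Type*}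
    [∀ i, MeasurableSpace (Ω i)] (μ : ∀ i, Measure (Ω i)) [∀ i, IsProbabilityMeasure (μ i)]
    {F : Type*} [NormedAddCommGroup F] [InnerProductSpace ℝ F] [CompleteSpace F]
    (v : ∀ i, Ω i → F) (hv : ∀ i, MemLp (v i) 2 (μ i)) :
    ∫ x, ‖∑ i, v i (x i)‖ ^ 2 ∂(Measure.pi μ)
      ≤ ∑ i, ∫ x, ‖v i x‖ ^ 2 ∂(μ i) + ‖∑ i, ∫ x, v i x ∂(μ i)‖ ^ 2 := by
  classical
  have hm : ∀ i, MemLp (fun x : ∀ i, Ω i => v i (x i)) 2 (Measure.pi μ) := fun i =>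
    (hv i).comp_measurePreserving (measurePreserving_eval μ i)
  have hint : ∀ i j, Integrable (fun x : ∀ i, Ω i => inner ℝ (v i (x i)) (v j (x j)))
      (Measure.pi μ) := fun i j => by
    refine ((hm i).norm.integrable_mul (hm j).norm).mono' ((hm i).1.inner (hm j).1)
      (ae_of_all _ fun x => norm_inner_le_norm _ _)
  have heval2 : ∀ i, ∫ x, ‖v i (x i)‖ ^ 2 ∂(Measure.pi μ) = ∫ x, ‖v i x‖ ^ 2 ∂(μ i) := fun i =>
    integral_comp_eval (f := fun x => ‖v i x‖ ^ 2) ((hv i).1.norm.pow 2)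
  have hoff : ∀ i j, i ≠ j → ∫ x, inner ℝ (v i (x i)) (v j (x j)) ∂(Measure.pi μ)
      = inner ℝ (∫ x, v i x ∂(μ i)) (∫ x, v j x ∂(μ j)) := fun i j hij => by
    have hp := measurePreserving_eval_pair μ hij
    have h1 := integral_prod_bilin (innerSL ℝ) ((hv i).integrable one_le_two)
      ((hv j).integrable one_le_two)
    change _ = inner ℝ _ _ at h1
    rw [← h1, ← hp.map_eq, integral_map (by fun_prop)]
    · rfl
    · rw [hp.map_eq]
      exact ((hv i).1.comp_fst).inner ((hv j).1.comp_snd)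
  simp_rw [← real_inner_self_eq_norm_sq, sum_inner, inner_sum]
  rw [integral_finsetSum _ fun i _ => integrable_finsetSum _ fun j _ => hint i j,
    ← Finset.sum_add_distrib]
  refine Finset.sum_le_sum fun i _ => ?_
  rw [integral_finsetSum _ fun j _ => hint i j]
  have hd : ∫ x, inner ℝ (v i x) (v i x) ∂(μ i)
      = ∑ j, if i = j then ∫ x, inner ℝ (v i x) (v i x) ∂(μ i) else 0 := by simp
  rw [hd, ← Finset.sum_add_distrib]
  refine Finset.sum_le_sum fun j _ => ?_
  by_cases hij : i = j
  · subst hij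
    have := heval2 i
    simp_rw [← real_inner_self_eq_norm_sq] at this
    rw [this, if_pos rfl]
    exact le_add_of_nonneg_right real_inner_self_nonneg
  · rw [if_neg hij, hoff i j hij, zero_add]

/-- The variance of φ is at most its mean squared distance from the value φ z. The bound is put as
one on the uncentred second moment so that it can be integrated over the remaining coordinates in
`variance_pi_le`. -/
lemma memLp_and_integral_sq_le {E : Type*} [NormedAddCommGroup E] [MeasurableSpace E]
    [BorelSpace E] [SecondCountableTopology E] (μ : Measure E) [IsProbabilityMeasure μ] {z : E}
    {V c : ℝ} (hz : MemLp (fun x => x - z) 2 μ) (hV : ∫ x, ‖x - z‖ ^ 2 ∂μ ≤ V) {φ : E → ℝ}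
    (hφ : ∀ a b, |φ a - φ b| ≤ c * ‖a - b‖) :
    MemLp φ 2 μ ∧ ∫ x, φ x ^ 2 ∂μ ≤ (∫ x, φ x ∂μ) ^ 2 + V * c ^ 2 := by
  have hcont : Continuous φ := by
    rw [continuous_iff_continuousAt]
    intro x
    refine tendsto_iff_norm_sub_tendsto_zero.2 ?_
    have h0 : Filter.Tendsto (fun x' => c * ‖x' - x‖) (nhds x) (nhds 0) := by
      have : Continuous (fun x' : E => c * ‖x' - x‖) := by fun_prop
      simpa using this.tendsto x
    exact squeeze_zero (fun _ => norm_nonneg _) (fun x' => hφ x' x) h0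
  have hsub : MemLp (fun x => φ x - φ z) 2 μ := by
    refine (hz.norm.const_mul c).mono' (by fun_prop) (ae_of_all _ fun x => hφ x z)
  have hL : MemLp φ 2 μ := by
    refine (hsub.add (memLp_const (φ z))).ae_eq (ae_of_all _ fun x => ?_)
    simp
  refine ⟨hL, ?_⟩
  have h1 := variance_eq_sub hL
  have h2 := variance_sub_const hL.1 (φ z)
  have h3 := variance_le_expectation_sq (X := fun x => φ x - φ z) hsub.1
  have h4 : ∫ x, (φ x - φ z) ^ 2 ∂μ ≤ ∫ x, c ^ 2 * ‖x - z‖ ^ 2 ∂μ := by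
    refine integral_mono hsub.integrable_sq (hz.norm.integrable_sq.const_mul _) fun x => ?_
    have := pow_le_pow_left₀ (abs_nonneg _) (hφ x z) 2
    rwa [sq_abs, mul_pow] at this
  rw [integral_const_mul] at h4
  have h5 : c ^ 2 * ∫ x, ‖x - z‖ ^ 2 ∂μ ≤ c ^ 2 * V := by gcongr
  simp only [Pi.pow_apply] at h1 h3
  linarith

lemma memLp_of_abs_sub_le {ι : Type*} [Fintype ι] {E : Type*} [NormedAddCommGroup E]
    [MeasurableSpace E] [BorelSpace E] [SecondCountableTopology E]
    (μ : ι → Measure E) [∀ i, IsProbabilityMeasure (μ i)] (z : ι → E)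
    (hz : ∀ i, MemLp (fun x => x - z i) 2 (μ i)) (c : ι → ℝ) (F : (ι → E) → ℝ)
    (hF : ∀ x x', |F x - F x'| ≤ ∑ i, c i * ‖x i - x' i‖) : MemLp F 2 (Measure.pi μ) := by
  have hcont : Continuous F := by
    rw [continuous_iff_continuousAt]
    intro x
    refine tendsto_iff_norm_sub_tendsto_zero.2 ?_
    have h0 : Filter.Tendsto (fun x' => ∑ i, c i * ‖x' i - x i‖) (nhds x) (nhds 0) := by
      have : Continuous (fun x' : ι → E => ∑ i, c i * ‖x' i - x i‖) := by fun_prop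
      simpa using this.tendsto x
    exact squeeze_zero (fun _ => norm_nonneg _) (fun x' => hF x' x) h0
  have hB : MemLp (fun x : ι → E => |F z| + ∑ i, c i * ‖x i - z i‖) 2 (Measure.pi μ) := by
    have h1 : ∀ i, MemLp (fun x : ι → E => c i * ‖x i - z i‖) 2 (Measure.pi μ) := fun i => by
      have h2 : MemLp (fun x : E => c i * ‖x - z i‖) 2 (μ i) := (hz i).norm.const_mul (c i)
      exact h2.comp_measurePreserving (measurePreserving_eval μ i)
    exact (memLp_const |F z|).add (memLp_finsetSum _ fun i _ => h1 i)
  refine hB.mono' hcont.aestronglyMeasurable (ae_of_all _ fun x => ?_)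
  have h1 := hF x z
  have h2 := abs_sub_abs_le_abs_sub (F x) (F z)
  rw [Real.norm_eq_abs]
  linarith

/-- Tensorization of the variance for functions that are Lipschitz in each coordinate. -/
lemma variance_pi_le {E : Type*} [NormedAddCommGroup E] [MeasurableSpace E] [BorelSpace E]
    [SecondCountableTopology E] {V : ℝ} (n : ℕ) (μ : Fin n → Measure E)
    [∀ i, IsProbabilityMeasure (μ i)] (z : Fin n → E)
    (hz : ∀ i, MemLp (fun x => x - z i) 2 (μ i)) (hV : ∀ i, ∫ x, ‖x - z i‖ ^ 2 ∂(μ i) ≤ V)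
    (c : Fin n → ℝ) (F : (Fin n → E) → ℝ)
    (hF : ∀ x x', |F x - F x'| ≤ ∑ i, c i * ‖x i - x' i‖) :
    Var[F; Measure.pi μ] ≤ V * ∑ i, c i ^ 2 := by
  induction n with
  | zero =>
    have : F = fun _ => F (fun i => i.elim0) := by
      funext x; congr 1; exact Subsingleton.elim _ _
    rw [this]
    simp [variance_eq_integral]
  | succ n ih =>
    have hL2 := memLp_of_abs_sub_le μ z hz c F hF
    have hmp := (measurePreserving_piFinSuccAbove μ 0).symm
    set ν : Measure (Fin n → E) := Measure.pi fun j => μ (Fin.succAbove 0 j) with hν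
    set H : E → (Fin n → E) → ℝ := fun a x => F (Fin.cons a x) with hH
    have he : ∀ p : E × (Fin n → E),
        (MeasurableEquiv.piFinSuccAbove (fun _ => E) 0).symm p = Fin.cons p.1 p.2 := by
      intro p
      simp [MeasurableEquiv.piFinSuccAbove_symm_apply, Fin.insertNthEquiv]
    have hHL2 : MemLp (fun p : E × (Fin n → E) => H p.1 p.2) 2 ((μ 0).prod ν) := by
      have := hL2.comp_measurePreserving hmp
      refine this.ae_eq (ae_of_all _ fun p => ?_)
      simp only [Function.comp, he, hH]
    have hH0 : ∀ x a b, |H a x - H b x| ≤ c 0 * ‖a - b‖ := fun x a b => by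
      simpa [hH, Fin.sum_univ_succ] using hF (Fin.cons a x) (Fin.cons b x)
    have h1 := fun x => memLp_and_integral_sq_le (μ 0) (hz 0) (hV 0) (hH0 x)
    -- Law of total variance: integrating out the first coordinate preserves the Lipschitz weights
    -- in the others, so induction applies to G, while the inner variance costs at most V·c₀².
    set G : (Fin n → E) → ℝ := fun x => ∫ a, H a x ∂(μ 0) with hG
    have hGlip : ∀ x x', |G x - G x'| ≤ ∑ i, c (Fin.succ i) * ‖x i - x' i‖ := fun x x' => by
      rw [hG]
      dsimp only
      rw [← integral_sub ((h1 x).1.integrable one_le_two) ((h1 x').1.integrable one_le_two),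
        ← Real.norm_eq_abs]
      refine (norm_integral_le_of_norm_le_const (C := ∑ i, c (Fin.succ i) * ‖x i - x' i‖)
        (ae_of_all _ fun a => ?_)).trans (by simp)
      simpa [hH, Fin.sum_univ_succ] using hF (Fin.cons a x) (Fin.cons a x')
    have hvar := ih (fun j => μ (Fin.succAbove 0 j)) (fun j => z (Fin.succ j))
      (fun j => by simpa using hz j.succ) (fun j => by simpa using hV j.succ)
      (fun j => c j.succ) G hGlip
    have hGL2 := memLp_of_abs_sub_le (fun j => μ (Fin.succAbove 0 j)) (fun j => z (Fin.succ j))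
      (fun j => by simpa using hz j.succ) (fun j => c j.succ) G hGlip
    rw [← hν] at hvar hGL2
    have hEF : ∫ x, F x ∂(Measure.pi μ) = ∫ x, G x ∂ν := by
      rw [← hmp.integral_comp', hG, integral_prod_symm]
      · simp only [he, hH]
      · simpa only [he, hH] using hHL2.integrable one_le_two
    have hEF2 : ∫ x, F x ^ 2 ∂(Measure.pi μ) ≤ ∫ x, G x ^ 2 ∂ν + V * c 0 ^ 2 := by
      have h2 : ∫ x, F x ^ 2 ∂(Measure.pi μ) = ∫ x, ∫ a, H a x ^ 2 ∂(μ 0) ∂ν := by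
        rw [← hmp.integral_comp', integral_prod_symm]
        · simp only [he, hH]
        · simpa only [he, hH] using hHL2.integrable_sq
      have h3 : ∫ x, (G x ^ 2 + V * c 0 ^ 2) ∂ν = ∫ x, G x ^ 2 ∂ν + V * c 0 ^ 2 := by
        rw [integral_add hGL2.integrable_sq (integrable_const _)]
        simp
      rw [h2, ← h3]
      exact integral_mono hHL2.integrable_sq.integral_prod_right
        (hGL2.integrable_sq.add (integrable_const _)) fun x => (h1 x).2
    rw [variance_eq_sub hGL2] at hvar
    rw [variance_eq_sub hL2, Fin.sum_univ_succ]
    simp only [Pi.pow_apply] at hvar ⊢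
    rw [hEF]
    linarith

/-! ### Uniqueness and equivariance of the halving -/

/-- If A and A' had equal size but differed, some a ∈ A would lie in B' and some b ∈ A' in B. Then R
a b and R b a, so a = b by antisymmetry, a contradiction. It serves both the sorting order and the
order of the indices. -/
lemma halves_unique {ι : Type*} [DecidableEq ι] {R : ι → ι → Prop}
    (hR : ∀ a b, R a b → R b a → a = b) {A B A' B' : Finset ι} (hU : A ∪ B = A' ∪ B')
    (hd : Disjoint A B) (hd' : Disjoint A' B') (hc : A.card = A'.card)
    (h : ∀ a ∈ A, ∀ b ∈ B, R a b) (h' : ∀ a ∈ A', ∀ b ∈ B', R a b) : A = A' ∧ B = B' := by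
  have hA : A = A' := by
    by_contra hne
    obtain ⟨a, ha, ha'⟩ : ∃ a ∈ A, a ∉ A' := by
      by_contra! hsub
      exact hne (Finset.eq_of_subset_of_card_le hsub hc.ge)
    obtain ⟨b, hb, hb'⟩ : ∃ b ∈ A', b ∉ A := by
      by_contra! hsub
      exact hne (Finset.eq_of_subset_of_card_le hsub hc.le).symm
    have haB : a ∈ B' := by
      have : a ∈ A' ∪ B' := hU ▸ Finset.mem_union_left _ ha
      exact (Finset.mem_union.1 this).resolve_left ha'
    have hbB : b ∈ B := by
      have : b ∈ A ∪ B := hU ▸ Finset.mem_union_left _ hb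
      exact (Finset.mem_union.1 this).resolve_left hb'
    exact ha' (hR a b (h a ha b hbB) (h' b hb a haB) ▸ hb)
  refine ⟨hA, ?_⟩
  subst hA
  rw [← Finset.union_sdiff_cancel_left hd, hU, Finset.union_sdiff_cancel_left hd']

lemma exists_eq_append {d : ℕ} (w : Fin (d + 1) → Bool) :
    ∃ (u : Fin d → Bool) (p : Bool), w = append u p :=
  ⟨Fin.init w, w (Fin.last d), (Fin.snoc_init_self w).symm⟩

lemma sum_words_succ {M : Type*} [AddCommMonoid M] {d : ℕ} (F : (Fin (d + 1) → Bool) → M) :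
    ∑ w, F w = ∑ u : Fin d → Bool, (F (append u false) + F (append u true)) := by
  rw [← (Fin.snocEquiv (fun _ : Fin (d + 1) => Bool)).sum_comp, Fintype.sum_prod_type_right]
  refine Finset.sum_congr rfl fun u _ => ?_
  rw [Fintype.sum_bool, add_comm]
  rfl

/-- The relation by which samples are sorted along coordinate `k`. -/
def Precedes {N K : ℕ} (y : Fin N → EuclideanSpace ℝ (Fin K)) (t : Fin N → ℝ) (i j : Fin N)
    (k : Fin K) : Prop :=
  y i k < y j k ∨ (y i k = y j k ∧ t i ≤ t j)

/-- The marks resolve all ties between the samples. -/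
def TieFree {N K : ℕ} (y : Fin N → EuclideanSpace ℝ (Fin K)) (t : Fin N → ℝ) : Prop :=
  ∀ i j, i ≠ j → ∀ k, y i k = y j k → t i ≠ t j

lemma TieFree.precedes_antisymm {N K : ℕ} {y : Fin N → EuclideanSpace ℝ (Fin K)} {t : Fin N → ℝ}
    (h : TieFree y t) (k : Fin K) (i j : Fin N) (hij : Precedes y t i j k)
    (hji : Precedes y t j i k) : i = j := by
  by_contra hne
  rcases hij with hij | ⟨h1, h2⟩ <;> rcases hji with hji | ⟨h3, h4⟩
  · exact lt_asymm hij hji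
  · exact hij.ne h3.symm
  · exact hji.ne h1.symm
  · exact h i j hne k h1 (le_antisymm h2 h4)

section Halving

variable {K m : ℕ} [NeZero K] {y : Fin (2 ^ m) → EuclideanSpace ℝ (Fin K)} {t : Fin (2 ^ m) → ℝ}
  {B B' : (d : ℕ) → (Fin d → Bool) → Finset (Fin (2 ^ m))}

lemma IsHalving.card_eq (h : IsHalving m y t B B') {d : ℕ} (hd : d ≤ m) (u : Fin d → Bool) :
    (B d u).card = 2 ^ (m - d) := by
  cases d with
  | zero => simp [h.root]
  | succ d =>
    obtain ⟨v, p, rfl⟩ := exists_eq_append u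
    exact h.card d hd v p

/-- Samples and marks enter the algorithm only through their order relations. This reduces the
choice of blocks to finitely many cases. -/
lemma IsHalving.congr (h : IsHalving m y t B B') {y' : Fin (2 ^ m) → EuclideanSpace ℝ (Fin K)}
    {t' : Fin (2 ^ m) → ℝ} (he : Precedes y t = Precedes y' t') : IsHalving m y' t' B B' where
  root := h.root
  union := h.union
  union' := h.union'
  disjoint := h.disjoint
  disjoint' := h.disjoint'
  card := h.card
  card' := h.card'
  sorted d hd u i₀ h₀ i₁ h₁ := by
    have h1 : Precedes y t i₀ i₁ (Fin.ofNat K d) := h.sorted d hd u i₀ h₀ i₁ h₁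
    rw [he] at h1
    exact h1
  sorted' := h.sorted'

/-- Relabelling the samples by τ relabels the sorted blocks: at each level both families cut the
same parent by the same antisymmetric order. The index halves have no such equivariance, and this
asymmetry is what the exchange argument exploits. -/
lemma IsHalving.mem_iff_of_perm (h : IsHalving m y t B B') (ht : TieFree y t)
    (τ : Equiv.Perm (Fin (2 ^ m))) {C C' : (d : ℕ) → (Fin d → Bool) → Finset (Fin (2 ^ m))}
    (hC : IsHalving m (y ∘ τ) (t ∘ τ) C C') {d : ℕ} (hd : d ≤ m) (u : Fin d → Bool)
    (i : Fin (2 ^ m)) : i ∈ C d u ↔ τ i ∈ B d u := by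
  suffices hs : ∀ d ≤ m, ∀ u : Fin d → Bool, C d u = (B d u).map τ.symm.toEmbedding by
    rw [hs d hd u, Finset.mem_map_equiv, Equiv.symm_symm]
  clear i u hd d
  intro d
  induction d with
  | zero => intro _ u; simp [h.root, hC.root]
  | succ d ih =>
    intro hd w
    obtain ⟨u, p, rfl⟩ := exists_eq_append w
    have key := halves_unique (R := fun i j => Precedes y t (τ i) (τ j) (Fin.ofNat K d))
      (A := C (d + 1) (append u false)) (B := C (d + 1) (append u true))
      (A' := (B (d + 1) (append u false)).map τ.symm.toEmbedding)
      (B' := (B (d + 1) (append u true)).map τ.symm.toEmbedding)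
      (fun a b hab hba => τ.injective (ht.precedes_antisymm _ _ _ hab hba))
      (by rw [hC.union d hd u, ← Finset.map_union, h.union d hd u, ih (by omega)])
      (hC.disjoint d hd u) ((Finset.disjoint_map _).2 (h.disjoint d hd u))
      (by rw [Finset.card_map, hC.card d hd, h.card d hd])
      (fun a ha b hb => hC.sorted d hd u a ha b hb)
      (fun a ha b hb => by
        rw [Finset.mem_map_equiv, Equiv.symm_symm] at ha hb
        exact h.sorted d hd u _ ha _ hb)
    cases p
    exacts [key.1, key.2]

lemma IsHalving.eq (h : IsHalving m y t B B') (ht : TieFree y t)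
    {C C' : (d : ℕ) → (Fin d → Bool) → Finset (Fin (2 ^ m))} (hC : IsHalving m y t C C')
    {d : ℕ} (hd : d ≤ m) (u : Fin d → Bool) : B d u = C d u := by
  ext i
  exact (h.mem_iff_of_perm ht 1 hC hd u i).symm

/-- The blocks split by index depend only on their parent block. -/
lemma IsHalving.index_halves_eq (h : IsHalving m y t B B')
    {y₂ : Fin (2 ^ m) → EuclideanSpace ℝ (Fin K)} {t₂ : Fin (2 ^ m) → ℝ}
    {C C' : (d : ℕ) → (Fin d → Bool) → Finset (Fin (2 ^ m))} (hC : IsHalving m y₂ t₂ C C')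
    {d : ℕ} (hd : d < m) {u : Fin d → Bool} (hu : B d u = C d u) :
    B' (d + 1) (append u false) = C' (d + 1) (append u false) ∧
      B' (d + 1) (append u true) = C' (d + 1) (append u true) :=
  halves_unique (R := fun i j => i ≤ j) (fun _ _ => le_antisymm)
    (by rw [h.union' d hd, hC.union' d hd, hu]) (h.disjoint' d hd u) (hC.disjoint' d hd u)
    (by rw [h.card' d hd, hC.card' d hd]) (h.sorted' d hd u) (hC.sorted' d hd u)

/-- Two members of a block can be exchanged without changing the block as a set; this makes the
event that the block equals S exchangeable in S. -/
lemma IsHalving.eq_of_swap (h : IsHalving m y t B B') (ht : TieFree y t) {a b : Fin (2 ^ m)}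
    {C C' : (d : ℕ) → (Fin d → Bool) → Finset (Fin (2 ^ m))}
    (hC : IsHalving m (y ∘ Equiv.swap a b) (t ∘ Equiv.swap a b) C C')
    {d : ℕ} (hd : d ≤ m) {u : Fin d → Bool} (ha : a ∈ B d u) (hb : b ∈ B d u) :
    C d u = B d u := by
  ext i
  rw [h.mem_iff_of_perm ht _ hC hd u i]
  by_cases hia : i = a
  · subst hia; simp [ha, hb]
  by_cases hib : i = b
  · subst hib; simp [ha, hb]
  rw [Equiv.swap_apply_of_ne_of_ne hia hib]

/-! ### The antithetic form of the estimator -/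

lemma IsHalving.sum_blocks (h : IsHalving m y t B B') {d : ℕ} (hd : d ≤ m) {M : Type*}
    [AddCommMonoid M] (φ : Fin (2 ^ m) → M) : ∑ u, ∑ i ∈ B d u, φ i = ∑ i, φ i := by
  induction d with
  | zero => simp [h.root]
  | succ d ih =>
    rw [sum_words_succ, ← ih (by omega)]
    refine Finset.sum_congr rfl fun u _ => ?_
    rw [← Finset.sum_union (h.disjoint d hd u), h.union d hd u]

/-- The empirical mean of `x` over a block. -/
noncomputable def blockMean {ι E : Type*} [AddCommGroup E] [Module ℝ E] (x : ι → E)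
    (S : Finset ι) : E :=
  (1 / S.card : ℝ) • ∑ i ∈ S, x i

/-- The antithetic difference of `f` between the mean of a block and the means of two halves. -/
noncomputable def splitDefect {ι E : Type*} [AddCommGroup E] [Module ℝ E] (f : E → ℝ) (x : ι → E)
    (S A B : Finset ι) : ℝ :=
  f (blockMean x S) - f (blockMean x A) / 2 - f (blockMean x B) / 2

/-- Level d of the sorted blocks is matched with level d + 1 of the index blocks, which halve the
same parents. The unmatched level m consists of singletons and gives the plain mean of f. -/
lemma IsHalving.estimator_eq (h : IsHalving m y t B B') {J : ℕ}
    (f : EuclideanSpace ℝ (Fin J) → ℝ) (x : Fin (2 ^ m) → EuclideanSpace ℝ (Fin J)) :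
    estimator m f x B B' = (1 / 2 ^ m : ℝ) * ∑ i, f (x i)
      + ∑ d ∈ Finset.range m, (1 / 2 ^ d : ℝ) * ∑ u : Fin d → Bool,
        splitDefect f x (B d u) (B' (d + 1) (append u false)) (B' (d + 1) (append u true)) := by
  have hlast : levelAverage m f x B m = (1 / 2 ^ m : ℝ) * ∑ i, f (x i) := by
    rw [levelAverage, ← h.sum_blocks le_rfl]
    congr 1
    refine Finset.sum_congr rfl fun u _ => ?_
    obtain ⟨i, hi⟩ := Finset.card_eq_one.1 ((h.card_eq le_rfl u).trans (by simp))
    simp [hi]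
  have hstep : ∀ d ∈ Finset.range m, (1 / 2 ^ d : ℝ) * ∑ u : Fin d → Bool,
        splitDefect f x (B d u) (B' (d + 1) (append u false)) (B' (d + 1) (append u true))
      = levelAverage m f x B d - levelAverage m f x B' (d + 1) := by
    intro d hd
    rw [Finset.mem_range] at hd
    rw [levelAverage, levelAverage, sum_words_succ, pow_succ]
    have : ∀ s : ℝ, (1 / (2 ^ d * 2) : ℝ) * s = (1 / 2 ^ d) * (s / 2) := fun s => by
      field_simp
    rw [this, ← mul_sub, Finset.sum_div, ← Finset.sum_sub_distrib]
    congr 1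
    refine Finset.sum_congr rfl fun u _ => ?_
    simp only [splitDefect, blockMean, h.card_eq hd.le, h.card' d hd, Nat.cast_pow, Nat.cast_ofNat]
    ring
  rw [Finset.sum_congr rfl hstep, Finset.sum_sub_distrib, estimator, Finset.sum_range_succ, hlast,
    Finset.range_eq_Ico, Finset.sum_Ico_add' (fun d => levelAverage m f x B' d) 0 m 1,
    zero_add, Finset.Ico_add_one_right_eq_Icc]
  ring

/-! ### Geometric decay of the block diameters -/

/-- Along each coordinate the blocks of level `d` lie in intervals whose average length decays
geometrically in the number of splits along that coordinate. -/
lemma IsHalving.exists_intervals (h : IsHalving m y t B B') {k : Fin K} {T : ℝ → ℝ}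
    (hT : ∀ s, T s ∈ Set.Icc (0 : ℝ) 1) (hmono : Monotone T) {d : ℕ} (hd : d ≤ m) :
    ∃ lo hi : (Fin d → Bool) → ℝ,
      (∀ u, ∀ i ∈ B d u, T (y i k) ∈ Set.Icc (lo u) (hi u)) ∧
      (∀ u, 0 ≤ hi u - lo u ∧ hi u - lo u ≤ 1) ∧
      (1 / 2 ^ d : ℝ) * ∑ u, (hi u - lo u)
        ≤ (1 / 2) ^ (Nat.count (fun e => Fin.ofNat K e = k) d) := by
  induction d with
  | zero => exact ⟨fun _ => 0, fun _ => 1, fun u i _ => hT _, by simp, by simp⟩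
  | succ d ih =>
    obtain ⟨lo, hi, h1, h2, h3⟩ := ih (by omega)
    have hsub : ∀ u p, B (d + 1) (append u p) ⊆ B d u := fun u p => by
      rw [← h.union d hd u]
      cases p
      exacts [Finset.subset_union_left, Finset.subset_union_right]
    by_cases hk : Fin.ofNat K d = k
    · have hne : ∀ u, (B (d + 1) (append u false)).Nonempty := fun u =>
        Finset.card_pos.1 (by rw [h.card d hd]; positivity)
      -- The cut point is the largest 𝒯-value in the lower half. By sorting and monotonicity it
      -- bounds the upper half from below, so the two child lengths add up to the parent length
      -- while the number of blocks doubles.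
      choose c hc hcmax using fun u =>
        (B (d + 1) (append u false)).exists_max_image (fun i => T (y i k)) (hne u)
      refine ⟨fun w => if w (Fin.last d) then T (y (c (Fin.init w)) k) else lo (Fin.init w),
        fun w => if w (Fin.last d) then hi (Fin.init w) else T (y (c (Fin.init w)) k), ?_, ?_, ?_⟩
      · intro w i hiw
        obtain ⟨u, p, rfl⟩ := exists_eq_append w
        have hin := h1 u i (hsub u p hiw)
        cases p
        · simpa [append] using ⟨hin.1, hcmax u i hiw⟩
        · simp only [append, Fin.snoc_last, Fin.init_snoc, if_true]
          refine ⟨hmono ?_, hin.2⟩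
          rcases h.sorted d hd u _ (hc u) _ hiw with h4 | h4
          · rw [hk] at h4; exact h4.le
          · rw [hk] at h4; exact h4.1.le
      · intro w
        obtain ⟨u, p, rfl⟩ := exists_eq_append w
        have hin := h1 u _ (hsub u false (hc u))
        have := h2 u
        cases p <;> simp [append] <;> constructor <;> linarith [hin.1, hin.2]
      · rw [sum_words_succ, Nat.count_succ, if_pos hk, pow_succ]
        simp only [append, Fin.snoc_last, Fin.init_snoc, if_true, Bool.false_eq_true, if_false]
        rw [pow_succ]
        have : ∀ u, T (y (c u) k) - lo u + (hi u - T (y (c u) k)) = hi u - lo u := fun u => by ring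
        simp only [this]
        have e : (1 / (2 ^ d * 2) : ℝ) * ∑ u, (hi u - lo u)
          = (1 / 2 ^ d : ℝ) * ∑ u, (hi u - lo u) * (1 / 2) := by
          rw [← Finset.sum_mul]; field_simp
        rw [e, ← Finset.sum_mul, ← mul_assoc]
        gcongr
    -- No split along k at this level: both children inherit the interval of their parent, and the
    -- average length is unchanged.
    · refine ⟨fun w => lo (Fin.init w), fun w => hi (Fin.init w), ?_, fun w => h2 _, ?_⟩
      · intro w i hiw
        obtain ⟨u, p, rfl⟩ := exists_eq_append w
        simpa [append] using h1 u i (hsub u p hiw)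
      · rw [sum_words_succ, Nat.count_succ, if_neg hk, add_zero]
        simp only [append, Fin.init_snoc]
        refine le_trans (le_of_eq ?_) h3
        rw [pow_succ, Finset.sum_add_distrib]
        field_simp
        ring

/-- The coordinates are used cyclically, so each occurs at least ⌊d/K⌋ times in the first d splits.
-/
lemma div_le_count_ofNat (K d : ℕ) [NeZero K] (k : Fin K) :
    d / K ≤ Nat.count (fun e => Fin.ofNat K e = k) d := by
  have h := Nat.count_modEq_card d (NeZero.pos K) (k : ℕ)
  have h2 : (fun e => Fin.ofNat K e = k) = (fun e => e ≡ (k : ℕ) [MOD K]) := by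
    funext e
    rw [Fin.ext_iff, Nat.ModEq, Nat.mod_eq_of_lt k.2]
    rfl
  simp only [h2]
  rw [h]
  exact Nat.le_add_right _ _

/-- The blocks of level `d` have small mean squared diameter after the transformation `𝒯`. -/
lemma IsHalving.exists_diam (h : IsHalving m y t B B') {T : Fin K → ℝ → ℝ}
    (hT : ∀ k s, T k s ∈ Set.Icc (0 : ℝ) 1) (hmono : ∀ k, Monotone (T k)) {d : ℕ} (hd : d ≤ m) :
    ∃ r : (Fin d → Bool) → ℝ,
      (∀ u, ∀ i ∈ B d u, ∀ j ∈ B d u, ‖coordMap T (y i) - coordMap T (y j)‖ ≤ r u) ∧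
      (∀ u, 0 ≤ r u ∧ r u ^ 2 ≤ K) ∧
      (1 / 2 ^ d : ℝ) * ∑ u, r u ^ 2 ≤ K * (1 / 2) ^ (d / K) := by
  choose lo hi h1 h2 h3 using fun k => h.exists_intervals (k := k) (hT k) (hmono k) hd
  have hsq : ∀ u, (√(∑ k, (hi k u - lo k u) ^ 2)) ^ 2 = ∑ k, (hi k u - lo k u) ^ 2 := fun u =>
    Real.sq_sqrt (Finset.sum_nonneg fun k _ => sq_nonneg _)
  refine ⟨fun u => √(∑ k, (hi k u - lo k u) ^ 2), ?_, fun u => ⟨Real.sqrt_nonneg _, ?_⟩, ?_⟩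
  · intro u i hiu j hju
    rw [EuclideanSpace.norm_eq]
    refine Real.sqrt_le_sqrt (Finset.sum_le_sum fun k _ => ?_)
    have hi1 := h1 k u i hiu
    have hj1 := h1 k u j hju
    rw [Real.norm_eq_abs]
    refine pow_le_pow_left₀ (abs_nonneg _) ?_ 2
    change |T k (y i k) - T k (y j k)| ≤ _
    rw [abs_le]
    constructor <;> linarith [hi1.1, hi1.2, hj1.1, hj1.2]
  · rw [hsq]
    calc _ ≤ ∑ k : Fin K, (1 : ℝ) := Finset.sum_le_sum fun k _ =>
          pow_le_one₀ (h2 k u).1 (h2 k u).2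
      _ = K := by simp
  · simp only [hsq]
    rw [Finset.sum_comm, Finset.mul_sum]
    calc _ ≤ ∑ k : Fin K, (1 / 2 : ℝ) ^ (d / K) := Finset.sum_le_sum fun k _ => by
          -- Lengths are at most 1, so squared lengths are bounded by lengths, whose average is what
          -- decays.
          refine le_trans ?_ ((h3 k).trans ?_)
          · gcongr with u
            exact pow_le_of_le_one (h2 k u).1 (h2 k u).2 two_ne_zero
          · exact pow_le_pow_of_le_one (by norm_num) (by norm_num) (div_le_count_ofNat K d k)
      _ = K * (1 / 2) ^ (d / K) := by simp

end Halving

/-! ### Weights of a split block -/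

/-- `A` and `B` are halves of the nonempty block `S`. -/
structure IsSplit {ι : Type*} [DecidableEq ι] (S A B : Finset ι) : Prop where
  union : A ∪ B = S
  disjoint : Disjoint A B
  card : A.card = B.card
  nonempty : S.Nonempty

/-- The coefficients of half the difference between the means of two halves of a block. -/
noncomputable def splitWeight {ι : Type*} [DecidableEq ι] (S A B : Finset ι) (j : ι) : ℝ :=
  (1 / S.card) * ((if j ∈ A then 1 else 0) - (if j ∈ B then 1 else 0))

section Split

variable {ι : Type*} [DecidableEq ι] {S A B : Finset ι}

lemma IsSplit.card_eq (h : IsSplit S A B) : S.card = 2 * A.card := by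
  rw [← h.union, Finset.card_union_of_disjoint h.disjoint, ← h.card, two_mul]

lemma IsSplit.card_pos (h : IsSplit S A B) : 0 < A.card := by
  have := Finset.card_pos.2 h.nonempty
  have := h.card_eq
  omega

lemma IsSplit.card_cast (h : IsSplit S A B) : (S.card : ℝ) = 2 * A.card := by
  rw [h.card_eq]; push_cast; ring

lemma IsSplit.abs_weight (h : IsSplit S A B) (j : ι) :
    |splitWeight S A B j| = (1 / S.card : ℝ) * if j ∈ S then 1 else 0 := by
  rw [splitWeight, abs_mul, abs_of_nonneg (by positivity : (0 : ℝ) ≤ 1 / S.card), ← h.union]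
  by_cases hA : j ∈ A
  · have := Finset.disjoint_left.1 h.disjoint hA
    simp [hA, this]
  · by_cases hB : j ∈ B <;> simp [hA, hB]

lemma IsSplit.weight_eq_zero (h : IsSplit S A B) {j : ι} (hj : j ∉ S) :
    splitWeight S A B j = 0 := by
  rw [← abs_eq_zero, h.abs_weight, if_neg hj, mul_zero]

variable [Fintype ι]

lemma sum_splitWeight_smul {E : Type*} [AddCommGroup E] [Module ℝ E] (x : ι → E) :
    ∑ j, splitWeight S A B j • x j = (1 / S.card : ℝ) • (∑ j ∈ A, x j - ∑ j ∈ B, x j) := by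
  simp only [splitWeight, mul_smul, sub_smul, ite_smul, one_smul, zero_smul, ← Finset.smul_sum,
    Finset.sum_sub_distrib]
  simp

lemma IsSplit.sum_weight (h : IsSplit S A B) : ∑ j, splitWeight S A B j = 0 := by
  have := sum_splitWeight_smul (S := S) (A := A) (B := B) (fun _ : ι => (1 : ℝ))
  simpa [h.card] using this

lemma IsSplit.sum_abs_weight (h : IsSplit S A B) : ∑ j, |splitWeight S A B j| = 1 := by
  have : (S.card : ℝ) ≠ 0 := by have := h.nonempty; positivity
  simp only [h.abs_weight, ← Finset.mul_sum]
  simp [this]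

lemma IsSplit.sum_weight_sq (h : IsSplit S A B) : ∑ j, splitWeight S A B j ^ 2 = 1 / S.card := by
  have h1 : ∀ j, splitWeight S A B j ^ 2 = (1 / S.card : ℝ) * |splitWeight S A B j| := fun j => by
    rw [← sq_abs, h.abs_weight]
    split_ifs <;> ring
  simp only [h1, ← Finset.mul_sum, h.sum_abs_weight, mul_one]

/-- With `IsSplit.blockMean_right`: the half means are the block mean plus and minus one vector,
which puts `splitDefect` in the form treated by `antithetic_sub_le`. -/
lemma IsSplit.blockMean_left (h : IsSplit S A B) {E : Type*} [AddCommGroup E] [Module ℝ E]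
    (x : ι → E) : blockMean x A = blockMean x S + ∑ j, splitWeight S A B j • x j := by
  have : (A.card : ℝ) ≠ 0 := by have := h.card_pos; positivity
  rw [sum_splitWeight_smul, blockMean, blockMean, h.card_cast, ← smul_add,
    ← h.union, Finset.sum_union h.disjoint, add_add_sub_cancel, ← two_smul ℝ, smul_smul]
  congr 1
  field_simp

lemma IsSplit.blockMean_right (h : IsSplit S A B) {E : Type*} [AddCommGroup E] [Module ℝ E]
    (x : ι → E) : blockMean x B = blockMean x S - ∑ j, splitWeight S A B j • x j := by
  have : (A.card : ℝ) ≠ 0 := by have := h.card_pos; positivity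
  rw [sum_splitWeight_smul, blockMean, blockMean, h.card_cast, ← smul_sub,
    ← h.union, Finset.sum_union h.disjoint, ← h.card, add_sub_sub_cancel, ← two_smul ℝ, smul_smul]
  congr 1
  field_simp

end Split

lemma integral_comp_of_measurePreserving {α β F : Type*} [MeasurableSpace α] [MeasurableSpace β]
    [NormedAddCommGroup F] [NormedSpace ℝ F] {μ : Measure α} {ν : Measure β} {g : α → β}
    (hg : MeasurePreserving g μ ν) {φ : β → F} (hφ : AEStronglyMeasurable φ ν) :
    ∫ a, φ (g a) ∂μ = ∫ b, φ b ∂ν := by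
  rw [← hg.map_eq] at hφ ⊢
  rw [integral_map hg.aemeasurable hφ]

/-! ### Replacing the laws in a block by a common law -/

section Bias

variable {ι : Type*} {S A B : Finset ι}
  {E : Type*} [NormedAddCommGroup E] [InnerProductSpace ℝ E] {f : E → ℝ} {α₁ α₂ : ℝ}

lemma norm_blockMean_sub_le (hS : S.Nonempty) (x x' : ι → E) {δ : ℝ}
    (h : ∀ j ∈ S, ‖x j - x' j‖ ≤ δ) : ‖blockMean x S - blockMean x' S‖ ≤ δ := by
  have hc : (0 : ℝ) < S.card := by exact_mod_cast Finset.card_pos.2 hS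
  rw [blockMean, blockMean, ← smul_sub, ← Finset.sum_sub_distrib, norm_smul, Real.norm_eq_abs,
    abs_of_nonneg (by positivity), div_mul_eq_mul_div, one_mul, div_le_iff₀ hc]
  calc _ ≤ ∑ j ∈ S, ‖x j - x' j‖ := norm_sum_le _ _
    _ ≤ ∑ j ∈ S, δ := Finset.sum_le_sum h
    _ = δ * S.card := by simp [mul_comm]

lemma abs_blockMean_sub_le (hα₁ : 0 ≤ α₁) (hf₁ : ∀ x y, |f x - f (x + y)| ≤ α₁ * ‖y‖)
    (x x' : ι → E) (S : Finset ι) :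
    |f (blockMean x S) - f (blockMean x' S)| ≤ α₁ / S.card * ∑ j ∈ S, ‖x j - x' j‖ := by
  have h := hf₁ (blockMean x S) (blockMean x' S - blockMean x S)
  rw [add_sub_cancel] at h
  refine h.trans ?_
  rw [blockMean, blockMean, ← smul_sub, ← Finset.sum_sub_distrib, norm_smul, Real.norm_eq_abs,
    abs_of_nonneg (by positivity), div_mul_eq_mul_div, one_mul, div_mul_eq_mul_div, mul_div_assoc]
  gcongr
  refine (norm_sum_le _ _).trans_eq (Finset.sum_congr rfl fun j _ => norm_sub_rev _ _)

variable [DecidableEq ι] [Fintype ι]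

/-- A sample in S moves f(mean over S) by α₁/|S| times its displacement, and half of f at one half
mean by α₁/(2|A|) = α₁/|S| times it, hence the factor 2. -/
lemma IsSplit.abs_splitDefect_sub_le (h : IsSplit S A B) (hα₁ : 0 ≤ α₁)
    (hf₁ : ∀ x y, |f x - f (x + y)| ≤ α₁ * ‖y‖) (x x' : ι → E) :
    |splitDefect f x S A B - splitDefect f x' S A B|
      ≤ ∑ j, (if j ∈ S then 2 * α₁ / S.card else 0) * ‖x j - x' j‖ := by
  have h1 := abs_blockMean_sub_le hα₁ hf₁ x x' S
  have h2 := abs_blockMean_sub_le hα₁ hf₁ x x' A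
  have h3 := abs_blockMean_sub_le hα₁ hf₁ x x' B
  have hc : (0 : ℝ) < A.card := by exact_mod_cast h.card_pos
  have hsum : ∑ j ∈ S, ‖x j - x' j‖ = ∑ j ∈ A, ‖x j - x' j‖ + ∑ j ∈ B, ‖x j - x' j‖ := by
    rw [← h.union, Finset.sum_union h.disjoint]
  simp only [ite_mul, zero_mul, Finset.sum_ite_mem, Finset.univ_inter, ← Finset.mul_sum]
  have e2 : α₁ / A.card * ∑ j ∈ A, ‖x j - x' j‖ = 2 * (α₁ / S.card * ∑ j ∈ A, ‖x j - x' j‖) := by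
    rw [h.card_cast]; field_simp
  have e3 : α₁ / B.card * ∑ j ∈ B, ‖x j - x' j‖ = 2 * (α₁ / S.card * ∑ j ∈ B, ‖x j - x' j‖) := by
    rw [h.card_cast, ← h.card]; field_simp
  rw [e2] at h2
  rw [e3] at h3
  have e1 : 2 * α₁ / S.card * ∑ j ∈ S, ‖x j - x' j‖
      = 2 * (α₁ / S.card * ∑ j ∈ S, ‖x j - x' j‖) := by ring
  have e4 : α₁ / S.card * ∑ j ∈ S, ‖x j - x' j‖
    = α₁ / S.card * ∑ j ∈ A, ‖x j - x' j‖ + α₁ / S.card * ∑ j ∈ B, ‖x j - x' j‖ := by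
    rw [hsum, mul_add]
  rw [e1]
  rw [splitDefect, splitDefect]
  rw [abs_le] at *
  constructor <;> linarith

lemma memLp_sub_const {E : Type*} [NormedAddCommGroup E] [MeasurableSpace E]
    {μ : Measure E} [IsProbabilityMeasure μ] (hμ : MemLp (fun x => x) 2 μ)
    (z : E) : MemLp (fun x => x - z) 2 μ :=
  hμ.sub (memLp_const z)

variable [MeasurableSpace E] [BorelSpace E] [SecondCountableTopology E] [CompleteSpace E]

/-- The mean antithetic difference over independent samples with laws `μ j` is close to the one
over independent samples with the common law `lam`, if the laws are close. -/
lemma IsSplit.sq_integral_splitDefect_sub_le (h : IsSplit S A B) (hα₁ : 0 ≤ α₁) (hα₂ : 0 ≤ α₂)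
    (hf₁ : ∀ x y, |f x - f (x + y)| ≤ α₁ * ‖y‖)
    (hf₂ : ∀ x y y', |f x - f (x + y) - f (x + y') + f (x + y + y')| ≤ α₂ * ‖y‖ * ‖y'‖)
    (μ : ι → Measure E) [∀ j, IsProbabilityMeasure (μ j)] (lam : Measure E)
    [IsProbabilityMeasure lam] (hμ : ∀ j, MemLp (fun x => x) 2 (μ j))
    (hlam : MemLp (fun x => x) 2 lam) {V D δ : ℝ}
    (hV : ∫ x, ‖x - ∫ x', x' ∂lam‖ ^ 2 ∂lam ≤ V) (hδ : 0 ≤ δ) (hδD : δ ^ 2 ≤ D)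
    (hγ : ∀ j ∈ S, ∃ γ : Measure (E × E), γ.fst = μ j ∧ γ.snd = lam ∧
      ∀ᵐ p ∂γ, ‖p.1 - p.2‖ ≤ δ) :
    (∫ x, splitDefect f x S A B ∂(Measure.pi μ)
        - ∫ x, splitDefect f x S A B ∂(Measure.pi fun _ : ι => lam)) ^ 2
      ≤ α₂ ^ 2 * (8 * V + D) *
        (δ ^ 2 / S.card + ‖∑ j, splitWeight S A B j • ∫ x, x ∂(μ j)‖ ^ 2) := by
  -- Outside S the product coupling is used: those coordinates do not enter, but a measure is needed
  -- there to form the product of couplings over all of ι.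
  have hγ' : ∀ j, ∃ γ : Measure (E × E), γ.fst = μ j ∧ γ.snd = lam ∧
      (j ∈ S → ∀ᵐ p ∂γ, ‖p.1 - p.2‖ ≤ δ) := fun j => by
    by_cases hj : j ∈ S
    · obtain ⟨γ, h1, h2, h3⟩ := hγ j hj
      exact ⟨γ, h1, h2, fun _ => h3⟩
    · exact ⟨(μ j).prod lam, by simp, by simp, fun h => absurd h hj⟩
  clear hγ
  choose γ hfst hsnd hγ using hγ'
  have hprob : ∀ j, IsProbabilityMeasure (γ j) := fun j => by
    constructor
    rw [← Measure.fst_univ, hfst]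
    exact measure_univ
  have mp1 : ∀ j, MeasurePreserving Prod.fst (γ j) (μ j) := fun j => ⟨measurable_fst, hfst j⟩
  have mp2 : ∀ j, MeasurePreserving Prod.snd (γ j) lam := fun j => ⟨measurable_snd, hsnd j⟩
  have MP1 : MeasurePreserving (fun (w : ι → E × E) j => (w j).1) (Measure.pi γ) (Measure.pi μ) :=
    measurePreserving_pi _ _ mp1
  have MP2 : MeasurePreserving (fun (w : ι → E × E) j => (w j).2) (Measure.pi γ)
      (Measure.pi fun _ : ι => lam) := measurePreserving_pi _ _ mp2
  set c : E := ∫ x', x' ∂lam with hc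
  set G := splitWeight S A B with hG
  set e := ‖∑ j, G j • ∫ x, x ∂(μ j)‖ with he
  set Z := fun x : ι → E => splitDefect f x S A B with hZ
  have hZ1 : MemLp Z 2 (Measure.pi μ) := memLp_of_abs_sub_le μ (fun _ => 0)
    (fun j => memLp_sub_const (hμ j) 0) _ Z (h.abs_splitDefect_sub_le hα₁ hf₁)
  have hZ2 : MemLp Z 2 (Measure.pi fun _ : ι => lam) := memLp_of_abs_sub_le _ (fun _ => 0)
    (fun j => memLp_sub_const hlam 0) _ Z (h.abs_splitDefect_sub_le hα₁ hf₁)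
  have hs : (1 : ℝ) ≤ S.card := by exact_mod_cast Finset.card_pos.2 h.nonempty
  -- the two increments
  set k := fun x : ι → E => ∑ j, G j • x j with hk
  have hk2 : MemLp (fun w : ι → E × E => k fun j => (w j).2) 2 (Measure.pi γ) := by
    refine memLp_finsetSum _ fun j _ => ?_
    have h1 : MemLp (fun p : E × E => G j • p.2) 2 (γ j) :=
      (hlam.comp_measurePreserving (mp2 j)).const_smul (G j)
    exact h1.comp_measurePreserving (measurePreserving_eval γ j)
  have hη : ∀ j, MemLp (fun p : E × E => G j • (p.1 - p.2)) 2 (γ j) := fun j =>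
    (((hμ j).comp_measurePreserving (mp1 j)).sub
      (hlam.comp_measurePreserving (mp2 j))).const_smul (G j)
  have hint1 : ∀ j, Integrable (fun p : E × E => p.1) (γ j) := fun j =>
    ((hμ j).comp_measurePreserving (mp1 j)).integrable one_le_two
  have hint2 : ∀ j, Integrable (fun p : E × E => p.2) (γ j) := fun j =>
    (hlam.comp_measurePreserving (mp2 j)).integrable one_le_two
  have hkk : ∀ w : ι → E × E, (k fun j => (w j).1) - (k fun j => (w j).2)
      = ∑ j, G j • ((w j).1 - (w j).2) := fun w => by
    simp only [hk, ← Finset.sum_sub_distrib, smul_sub]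
  have hη2 : MemLp (fun w : ι → E × E => (k fun j => (w j).1) - (k fun j => (w j).2)) 2
      (Measure.pi γ) := by
    simp only [hkk]
    exact memLp_finsetSum _ fun j _ => (hη j).comp_measurePreserving (measurePreserving_eval γ j)
  -- second moment of the common increment
  have hk_sq : ∫ w, ‖k fun j => (w j).2‖ ^ 2 ∂(Measure.pi γ) ≤ V / S.card := by
    -- The weights sum to zero, so every sample may be centred at c. The means then vanish, and the
    -- squared weights, of sum 1/|S|, give V/|S|.
    have h1 : ∀ w : ι → E × E, (k fun j => (w j).2) = ∑ j, G j • ((w j).2 - c) := fun w => by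
      simp only [hk, smul_sub, Finset.sum_sub_distrib, ← Finset.sum_smul]
      rw [h.sum_weight, zero_smul, sub_zero]
    have hv : ∀ j, MemLp (fun p : E × E => G j • (p.2 - c)) 2 (γ j) := fun j =>
      ((memLp_sub_const hlam c).comp_measurePreserving (mp2 j)).const_smul (G j)
    have h2 := integral_norm_sq_sum_pi_le γ (fun j p => G j • (p.2 - c)) hv
    have h3 : ∀ j, ∫ p : E × E, G j • (p.2 - c) ∂(γ j) = 0 := fun j => by
      rw [integral_smul, integral_comp_of_measurePreserving (mp2 j) (φ := fun x => x - c)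
        (memLp_sub_const hlam c).1, integral_sub (hlam.integrable one_le_two)
        (integrable_const _), ← hc]
      simp
    have h4 : ∀ j, ∫ p : E × E, ‖G j • (p.2 - c)‖ ^ 2 ∂(γ j) ≤ G j ^ 2 * V := fun j => by
      simp only [norm_smul, mul_pow, Real.norm_eq_abs, sq_abs]
      rw [integral_const_mul, integral_comp_of_measurePreserving (mp2 j)
        (φ := fun x => ‖x - c‖ ^ 2) ((memLp_sub_const hlam c).1.norm.pow 2)]
      gcongr
    simp only [h1]
    refine h2.trans ?_
    simp only [h3, Finset.sum_const_zero, norm_zero]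
    refine (add_le_add_left (Finset.sum_le_sum fun j _ => h4 j) _).trans_eq ?_
    rw [← Finset.sum_mul, h.sum_weight_sq]
    ring
  have hη_sq : ∫ w, ‖(k fun j => (w j).1) - (k fun j => (w j).2)‖ ^ 2 ∂(Measure.pi γ)
      ≤ δ ^ 2 / S.card + e ^ 2 := by
    -- The common mean c cancels from the mean of the sum, which becomes the vector of norm e. The
    -- second moments of the coupled differences add up to at most δ²/|S|.
    have h2 := integral_norm_sq_sum_pi_le γ (fun j p => G j • (p.1 - p.2)) hη
    have h3 : ∀ j, ∫ p : E × E, G j • (p.1 - p.2) ∂(γ j)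
        = G j • ∫ x, x ∂(μ j) - G j • c := fun j => by
      rw [integral_smul, integral_sub (hint1 j) (hint2 j),
        integral_comp_of_measurePreserving (mp1 j) (φ := fun x => x) (hμ j).1,
        integral_comp_of_measurePreserving (mp2 j) (φ := fun x => x) hlam.1, smul_sub]
    have h4 : ∀ j, ∫ p : E × E, ‖G j • (p.1 - p.2)‖ ^ 2 ∂(γ j) ≤ G j ^ 2 * δ ^ 2 := fun j => by
      by_cases hj : j ∈ S
      · calc _ ≤ ∫ _, G j ^ 2 * δ ^ 2 ∂(γ j) := by
              refine integral_mono_ae (hη j).norm.integrable_sq (integrable_const _) ?_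
              filter_upwards [hγ j hj] with p hp
              rw [norm_smul, mul_pow, Real.norm_eq_abs, sq_abs]
              gcongr
          _ = _ := by simp
      · have : G j = 0 := h.weight_eq_zero hj
        simp [this]
    simp only [hkk]
    refine h2.trans ?_
    simp only [h3, Finset.sum_sub_distrib, ← Finset.sum_smul]
    rw [h.sum_weight, zero_smul, sub_zero]
    refine (add_le_add_left (Finset.sum_le_sum fun j _ => h4 j) _).trans_eq ?_
    rw [← Finset.sum_mul, h.sum_weight_sq]
    ring
  have hsum_le : ∀ v : ι → E, (∀ j ∈ S, ‖v j‖ ≤ δ) → ‖∑ j, G j • v j‖ ≤ δ := fun v hv => by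
    calc _ ≤ ∑ j, |G j| * δ := by
          refine (norm_sum_le _ _).trans (Finset.sum_le_sum fun j _ => ?_)
          rw [norm_smul, Real.norm_eq_abs]
          by_cases hj : j ∈ S
          · have := hv j hj
            gcongr
          · have : G j = 0 := h.weight_eq_zero hj
            simp [this]
      _ = δ := by rw [← Finset.sum_mul, h.sum_abs_weight, one_mul]
  have he_le : e ≤ δ := by
    have h1 : ∑ j, G j • ∫ x, x ∂(μ j) = ∑ j, G j • (∫ x, x ∂(μ j) - c) := by
      simp only [smul_sub, Finset.sum_sub_distrib, ← Finset.sum_smul]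
      rw [h.sum_weight, zero_smul, sub_zero]
    rw [he, h1]
    refine hsum_le _ fun j hj => ?_
    rw [hc, ← integral_comp_of_measurePreserving (mp1 j) (φ := fun x => x) (hμ j).1,
      ← integral_comp_of_measurePreserving (mp2 j) (φ := fun x => x) hlam.1, ← integral_sub (hint1 j) (hint2 j)]
    refine (norm_integral_le_of_norm_le_const (hγ j hj)).trans_eq ?_
    simp
  have hZk : ∀ x, Z x = f (blockMean x S) - f (blockMean x S + k x) / 2
      - f (blockMean x S - k x) / 2 := fun x => by
    simp only [hZ, splitDefect, hk, hG]
    rw [h.blockMean_left, h.blockMean_right]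
  have hpt : ∀ᵐ w ∂(Measure.pi γ), |Z (fun j => (w j).1) - Z (fun j => (w j).2)|
      ≤ α₂ * (2 * δ * ‖k fun j => (w j).2‖
        + ‖(k fun j => (w j).1) - (k fun j => (w j).2)‖ ^ 2 / 2) := by
    have hall : ∀ᵐ w ∂(Measure.pi γ), ∀ j, j ∈ S → ‖(w j).1 - (w j).2‖ ≤ δ := by
      refine ae_all_iff.2 fun j => ?_
      by_cases hj : j ∈ S
      · filter_upwards [(measurePreserving_eval γ j).quasiMeasurePreserving.ae (hγ j hj)]
          with w hw _ using hw
      · exact ae_of_all _ fun w h => absurd h hj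
    filter_upwards [hall] with w hw
    rw [hZk, hZk]
    refine (antithetic_sub_le hf₂ hα₂ _ _ _ _).trans ?_
    have h1 := norm_blockMean_sub_le h.nonempty (fun j => (w j).1) (fun j => (w j).2) hw
    have h2 : ‖(k fun j => (w j).1) - (k fun j => (w j).2)‖ ≤ δ := by
      rw [hkk]; exact hsum_le _ hw
    gcongr
    rw [two_mul, add_mul]
    gcongr
  set κ := ∫ w, ‖k fun j => (w j).2‖ ∂(Measure.pi γ) with hκ
  set η := ∫ w, ‖(k fun j => (w j).1) - (k fun j => (w j).2)‖ ^ 2 ∂(Measure.pi γ) with hηdef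
  have hκ_sq : κ ^ 2 ≤ V / S.card := by
    have h1 := variance_eq_sub hk2.norm
    have h2 := variance_nonneg (fun w : ι → E × E => ‖k fun j => (w j).2‖) (Measure.pi γ)
    simp only [Pi.pow_apply] at h1
    linarith
  have hκ0 : 0 ≤ κ := integral_nonneg fun w => norm_nonneg _
  have hη0 : 0 ≤ η := integral_nonneg fun w => by positivity
  have hZi1 : Integrable (fun w : ι → E × E => Z fun j => (w j).1) (Measure.pi γ) :=
    (hZ1.comp_measurePreserving MP1).integrable one_le_two
  have hZi2 : Integrable (fun w : ι → E × E => Z fun j => (w j).2) (Measure.pi γ) :=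
    (hZ2.comp_measurePreserving MP2).integrable one_le_two
  have hmain : |∫ x, Z x ∂(Measure.pi μ) - ∫ x, Z x ∂(Measure.pi fun _ : ι => lam)|
      ≤ α₂ * (2 * δ * κ + η / 2) := by
    rw [← integral_comp_of_measurePreserving MP1 hZ1.1,
      ← integral_comp_of_measurePreserving MP2 hZ2.1, ← integral_sub hZi1 hZi2, ← Real.norm_eq_abs]
    have hi1 : Integrable (fun w : ι → E × E => 2 * δ * ‖k fun j => (w j).2‖) (Measure.pi γ) :=
      (hk2.norm.integrable one_le_two).const_mul _
    have hi2 : Integrable (fun w : ι → E × E =>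
        ‖(k fun j => (w j).1) - (k fun j => (w j).2)‖ ^ 2 / 2) (Measure.pi γ) :=
      hη2.norm.integrable_sq.div_const _
    refine (norm_integral_le_of_norm_le ((hi1.add hi2).const_mul α₂) hpt).trans_eq ?_
    rw [integral_const_mul, integral_add' hi1 hi2, integral_const_mul, integral_div]
  have hsq := pow_le_pow_left₀ (abs_nonneg _) hmain 2
  rw [sq_abs] at hsq
  refine hsq.trans ?_
  have hV0 : 0 ≤ V := (integral_nonneg fun x => by positivity).trans hV
  have hR0 : 0 ≤ δ ^ 2 / S.card := by positivity
  have hR1 : δ ^ 2 / S.card ≤ D := (div_le_self (sq_nonneg δ) hs).trans hδD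
  have he1 : e ^ 2 ≤ D := (pow_le_pow_left₀ (norm_nonneg _) he_le 2).trans hδD
  -- From (s + t)² ≤ 2s² + 2t². The first term is controlled by 8V·δ²/|S|; for the second, one
  -- factor η is at most 2D and the other is at most δ²/|S| + e². Hence the constant 8V + D.
  have h1 : (2 * δ * κ + η / 2) ^ 2 ≤ 8 * (δ ^ 2 * κ ^ 2) + η ^ 2 / 2 := by
    nlinarith [sq_nonneg (2 * δ * κ - η / 2)]
  have h2 : δ ^ 2 * κ ^ 2 ≤ V * (δ ^ 2 / S.card) := by
    calc _ ≤ δ ^ 2 * (V / S.card) := by gcongr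
      _ = _ := by ring
  have h3 : η ^ 2 ≤ (2 * D) * (δ ^ 2 / S.card + e ^ 2) := by
    rw [sq]
    have h4 : η ≤ 2 * D := by linarith
    exact mul_le_mul h4 hη_sq hη0 (by linarith)
  rw [mul_pow, mul_assoc (α₂ ^ 2)]
  refine mul_le_mul_of_nonneg_left ?_ (sq_nonneg α₂)
  have : 0 ≤ V * e ^ 2 := by positivity
  linarith

end Bias

/-! ### Disintegration over the outer samples -/

lemma measurePreserving_comp_perm {ι α : Type*} [Fintype ι] [MeasurableSpace α] (ξ : Measure α)
    [SigmaFinite ξ] (τ : Equiv.Perm ι) :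
    MeasurePreserving (fun q : ι → α => q ∘ τ) (Measure.pi fun _ => ξ) (Measure.pi fun _ => ξ) := by
  have h := measurePreserving_piCongrLeft (fun _ : ι => ξ) τ.symm
  convert h using 1
  funext q i
  have := Equiv.piCongrLeft_apply_apply (fun _ : ι => α) τ.symm q (τ i)
  rw [Equiv.symm_apply_apply] at this
  exact this.symm

lemma measurable_pi_kernel {ι α β : Type*} [Fintype ι] [MeasurableSpace α] [MeasurableSpace β]
    (η : Kernel α β) [IsMarkovKernel η] :
    Measurable (fun a : ι → α => Measure.pi fun i => η (a i)) := by
  refine Measurable.measure_of_isPiSystem_of_isProbabilityMeasure generateFrom_pi.symm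
    isPiSystem_pi ?_
  rintro _ ⟨s, hs, rfl⟩
  simp only [Measure.pi_pi]
  exact Finset.measurable_prod _ fun i _ =>
    (η.measurable_coe (hs i (Set.mem_univ i))).comp (measurable_pi_apply i)

/-- The product of the kernel `η`. -/
noncomputable def piKernel (ι : Type*) {α β : Type*} [Fintype ι] [MeasurableSpace α]
    [MeasurableSpace β] (η : Kernel α β) [IsMarkovKernel η] : Kernel (ι → α) (ι → β) :=
  ⟨fun a => Measure.pi fun i => η (a i), measurable_pi_kernel η⟩

instance {ι α β : Type*} [Fintype ι] [MeasurableSpace α] [MeasurableSpace β] (η : Kernel α β)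
    [IsMarkovKernel η] : IsMarkovKernel (piKernel ι η) :=
  ⟨fun a => by change IsProbabilityMeasure (Measure.pi fun i => η (a i)); infer_instance⟩

lemma lintegral_prod_pi {ι α : Type*} [Fintype ι] [MeasurableSpace α] (ξ : Measure α)
    [IsProbabilityMeasure ξ] (φ : ι → α → ℝ≥0∞) (hφ : ∀ i, Measurable (φ i)) :
    ∫⁻ a, ∏ i, φ i (a i) ∂(Measure.pi fun _ : ι => ξ) = ∏ i, ∫⁻ a, φ i a ∂ξ := by
  rw [lintegral_prod_eq_prod_lintegral_of_indepFun Finset.univ (fun i (a : ι → α) => φ i (a i))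
    (iIndepFun_pi (μ := fun _ : ι => ξ) fun i => (hφ i).aemeasurable)
    (fun i => (hφ i).comp (measurable_pi_apply i))]
  refine Finset.prod_congr rfl fun i _ => ?_
  exact (measurePreserving_eval (fun _ : ι => ξ) i).lintegral_comp (hφ i)

/-- Independence of the pairs becomes conditional independence of the second components given the
first ones. Both measures agree on boxes, where the integral of a product factors. -/
lemma pi_compProd_eq_map {ι α β : Type*} [Fintype ι] [MeasurableSpace α] [MeasurableSpace β]
    (ξ : Measure α) [IsProbabilityMeasure ξ] (η : Kernel α β) [IsMarkovKernel η] :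
    (Measure.pi fun _ : ι => ξ ⊗ₘ η) = ((Measure.pi fun _ : ι => ξ) ⊗ₘ piKernel ι η).map
      (fun p i => (p.1 i, p.2 i)) := by
  have hmeas : Measurable (fun (p : (ι → α) × (ι → β)) i => (p.1 i, p.2 i)) := by fun_prop
  refine Measure.pi_eq fun s hs => ?_
  rw [Measure.map_apply hmeas (MeasurableSet.univ_pi hs), Measure.compProd_apply
    (hmeas (MeasurableSet.univ_pi hs))]
  have h1 : ∀ a : ι → α, piKernel ι η a (Prod.mk a ⁻¹'
      ((fun (p : (ι → α) × (ι → β)) i => (p.1 i, p.2 i)) ⁻¹' Set.univ.pi s))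
      = ∏ i, η (a i) (Prod.mk (a i) ⁻¹' s i) := fun a => by
    rw [← Measure.pi_pi]
    rfl
  simp only [h1]
  rw [lintegral_prod_pi ξ (fun i a => η a (Prod.mk a ⁻¹' s i))
    fun i => Kernel.measurable_kernel_prodMk_left (hs i)]
  refine Finset.prod_congr rfl fun i _ => ?_
  rw [Measure.compProd_apply (hs i)]

instance {J K : ℕ} (ρ : Measure (EuclideanSpace ℝ (Fin J) × EuclideanSpace ℝ (Fin K)))
    [IsFiniteMeasure ρ] : IsMarkovKernel (condLaw ρ) := by
  unfold condLaw; infer_instance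

section Law

variable {J K : ℕ} (ρ : Measure (EuclideanSpace ℝ (Fin J) × EuclideanSpace ℝ (Fin K)))
  [IsProbabilityMeasure ρ] (ν : Measure ℝ) [IsProbabilityMeasure ν]

lemma lintegral_eq_lintegral_condLaw
    {φ : EuclideanSpace ℝ (Fin J) × EuclideanSpace ℝ (Fin K) → ℝ≥0∞} (hφ : Measurable φ) :
    ∫⁻ p, φ p ∂ρ = ∫⁻ y, ∫⁻ x, φ (x, y) ∂(condLaw ρ y) ∂ρ.snd := by
  have h : ρ.map Prod.snd ⊗ₘ condDistrib Prod.fst Prod.snd ρ = ρ.map (fun p => (p.2, p.1)) :=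
    compProd_map_condDistrib measurable_fst.aemeasurable
  have h2 : ∫⁻ p, φ p ∂ρ = ∫⁻ p, φ (p.2, p.1) ∂(ρ.map (fun p => (p.2, p.1))) := by
    rw [lintegral_map (by fun_prop) (by fun_prop)]
  rw [h2, ← h, Measure.lintegral_compProd (by fun_prop)]
  rfl

/-- The law of `((Y, t), X)`, disintegrated. -/
lemma map_prod_eq_compProd :
    (ρ.prod ν).map (fun p => ((p.1.2, p.2), p.1.1))
      = (ρ.snd.prod ν) ⊗ₘ (Kernel.prodMkRight ℝ (condLaw ρ)) := by
  refine Measure.ext_of_lintegral _ fun φ hφ => ?_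
  rw [lintegral_map hφ (by fun_prop), Measure.lintegral_compProd hφ,
    lintegral_prod _ (by fun_prop),
    lintegral_prod _ (hφ.lintegral_kernel_prod_right'
      (κ := Kernel.prodMkRight ℝ (condLaw ρ))).aemeasurable,
    lintegral_eq_lintegral_condLaw ρ (by fun_prop)]
  refine lintegral_congr fun y => ?_
  simp only [Kernel.prodMkRight_apply]
  rw [lintegral_lintegral_swap (by fun_prop)]

/-- The expectation of a function of the samples is obtained by integrating first over the inner
samples given the outer samples and the marks. -/
lemma lintegral_samples {N : ℕ} {Ω : Type*} [MeasurableSpace Ω] (P : Measure Ω)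
    [IsProbabilityMeasure P] {X : Fin N → Ω → EuclideanSpace ℝ (Fin J)}
    {Y : Fin N → Ω → EuclideanSpace ℝ (Fin K)} {t : Fin N → Ω → ℝ}
    (hX : ∀ i, Measurable (X i)) (hY : ∀ i, Measurable (Y i)) (ht : ∀ i, Measurable (t i))
    (hind : iIndepFun (fun i ω => ((X i ω, Y i ω), t i ω)) P)
    (hlaw : ∀ i, P.map (fun ω => ((X i ω, Y i ω), t i ω)) = ρ.prod ν)
    {H : (Fin N → EuclideanSpace ℝ (Fin J)) → (Fin N → EuclideanSpace ℝ (Fin K) × ℝ) → ℝ≥0∞}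
    (hH : Measurable (Function.uncurry H)) :
    ∫⁻ ω, H (fun i => X i ω) (fun i => (Y i ω, t i ω)) ∂P
      = ∫⁻ q, ∫⁻ x, H x q ∂(Measure.pi fun i => condLaw ρ (q i).1)
          ∂(Measure.pi fun _ => ρ.snd.prod ν) := by
  have hmeas : ∀ i, Measurable (fun ω => ((X i ω, Y i ω), t i ω)) := fun i =>
    ((hX i).prodMk (hY i)).prodMk (ht i)
  have h1 : P.map (fun ω i => ((X i ω, Y i ω), t i ω)) = Measure.pi fun _ => ρ.prod ν := by
    rw [(iIndepFun_iff_map_fun_eq_pi_map fun i => (hmeas i).aemeasurable).1 hind]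
    simp only [hlaw]
  have h2 : P.map (fun ω i => ((Y i ω, t i ω), X i ω))
      = Measure.pi fun _ => (ρ.snd.prod ν) ⊗ₘ (Kernel.prodMkRight ℝ (condLaw ρ)) := by
    rw [← map_prod_eq_compProd, ← Measure.pi_map_pi (fun i => by fun_prop), ← h1,
      Measure.map_map (by fun_prop) (by fun_prop)]
    rfl
  have hH' : Measurable (fun w : Fin N → (EuclideanSpace ℝ (Fin K) × ℝ) × EuclideanSpace ℝ (Fin J)
      => H (fun i => (w i).2) (fun i => (w i).1)) :=
    hH.comp (f := fun w : Fin N → (EuclideanSpace ℝ (Fin K) × ℝ) × EuclideanSpace ℝ (Fin J) =>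
      ((fun i => (w i).2), (fun i => (w i).1))) (by fun_prop)
  have h3 : ∫⁻ ω, H (fun i => X i ω) (fun i => (Y i ω, t i ω)) ∂P
      = ∫⁻ w, H (fun i => (w i).2) (fun i => (w i).1)
        ∂(P.map (fun ω i => ((Y i ω, t i ω), X i ω))) := by
    rw [lintegral_map hH' (by fun_prop)]
  rw [h3, h2, pi_compProd_eq_map, lintegral_map hH' (by fun_prop)]
  exact Measure.lintegral_compProd (f := fun p => H p.2 p.1) (hH.comp measurable_swap)

lemma map_outer_samples {N : ℕ} {Ω : Type*} [MeasurableSpace Ω] (P : Measure Ω)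
    [IsProbabilityMeasure P] {X : Fin N → Ω → EuclideanSpace ℝ (Fin J)}
    {Y : Fin N → Ω → EuclideanSpace ℝ (Fin K)} {t : Fin N → Ω → ℝ}
    (hX : ∀ i, Measurable (X i)) (hY : ∀ i, Measurable (Y i)) (ht : ∀ i, Measurable (t i))
    (hind : iIndepFun (fun i ω => ((X i ω, Y i ω), t i ω)) P)
    (hlaw : ∀ i, P.map (fun ω => ((X i ω, Y i ω), t i ω)) = ρ.prod ν) :
    P.map (fun ω i => (Y i ω, t i ω)) = Measure.pi fun _ => ρ.snd.prod ν := by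
  refine Measure.ext_of_lintegral _ fun φ hφ => ?_
  rw [lintegral_map hφ (by fun_prop)]
  have := lintegral_samples ρ ν P hX hY ht hind hlaw (H := fun _ q => φ q)
    (hφ.comp measurable_snd)
  simpa using this

end Law

/-! ### Exchangeability inside a block -/

/-- Each a ∈ A gets its own partner in B, so exchanging one pair reverses the difference attached to
that pair and leaves all the others alone. -/
lemma IsSplit.exists_pairing {ι : Type*} [DecidableEq ι] {S A B : Finset ι} (h : IsSplit S A B) :
    ∃ σ : ι → ι, (∀ a ∈ A, σ a ∈ B) ∧ (∀ a ∈ A, ∀ b ∈ A, σ a = σ b → a = b) ∧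
      A.image σ = B := by
  set e := Finset.equivOfCardEq h.card
  have hσ : ∀ a (ha : a ∈ A), (if ha : a ∈ A then (e ⟨a, ha⟩ : ι) else a) = e ⟨a, ha⟩ :=
    fun a ha => dif_pos ha
  have hB : ∀ a ∈ A, (if ha : a ∈ A then (e ⟨a, ha⟩ : ι) else a) ∈ B := fun a ha => by
    rw [hσ a ha]; exact (e ⟨a, ha⟩).2
  have hinj : ∀ a ∈ A, ∀ b ∈ A, (if ha : a ∈ A then (e ⟨a, ha⟩ : ι) else a)
      = (if hb : b ∈ A then (e ⟨b, hb⟩ : ι) else b) → a = b := fun a ha b hb hab => by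
    rw [hσ a ha, hσ b hb] at hab
    exact congrArg Subtype.val (e.injective (Subtype.ext hab))
  refine ⟨fun a => if ha : a ∈ A then e ⟨a, ha⟩ else a, hB, hinj, ?_⟩
  refine Finset.eq_of_subset_of_card_le (Finset.image_subset_iff.2 hB) ?_
  rw [Finset.card_image_of_injOn (fun a ha b hb => hinj a ha b hb), h.card]

/-- Superadditivity of the lower integral, with no measurability of φ. It is applied to block radii
that are chosen pointwise. -/
lemma sum_lintegral_le {ι α : Type*} [MeasurableSpace α] (μ : Measure α) (s : Finset ι)
    (φ : ι → α → ℝ≥0∞) : ∑ i ∈ s, ∫⁻ a, φ i a ∂μ ≤ ∫⁻ a, ∑ i ∈ s, φ i a ∂μ := by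
  classical
  induction s using Finset.induction_on with
  | empty => simp
  | insert i s hi ih =>
    simp only [Finset.sum_insert hi]
    exact (add_le_add_right ih _).trans (le_lintegral_add _ _)

/-- The difference between the means over two halves of a block is controlled by its diameter if
the law of the sample is invariant under exchanges within the block. -/
lemma IsSplit.setLIntegral_sum_weight_le {ι α E : Type*} [Fintype ι] [DecidableEq ι]
    [MeasurableSpace α] [NormedAddCommGroup E] [InnerProductSpace ℝ E] {S A B : Finset ι}
    (h : IsSplit S A B) (ξ : Measure α) [IsProbabilityMeasure ξ] {G : α → E}
    (hG : StronglyMeasurable G) {Ev : Set (ι → α)} (hEv : MeasurableSet Ev)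
    (hinv : ∀ a ∈ S, ∀ b ∈ S, ∀ᵐ q ∂(Measure.pi fun _ => ξ), q ∘ Equiv.swap a b ∈ Ev ↔ q ∈ Ev)
    {R : (ι → α) → ℝ} {D : ℝ}
    (hR : ∀ᵐ q ∂(Measure.pi fun _ => ξ), q ∈ Ev →
      R q ≤ D ∧ ∀ i ∈ S, ∀ j ∈ S, ‖G (q i) - G (q j)‖ ≤ R q) :
    ∫⁻ q in Ev, ENNReal.ofReal (‖∑ j, splitWeight S A B j • G (q j)‖ ^ 2)
        ∂(Measure.pi fun _ => ξ)
      ≤ ∫⁻ q in Ev, ENNReal.ofReal (R q ^ 2 / S.card) ∂(Measure.pi fun _ => ξ) := by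
  obtain ⟨σ, hσB, hσinj, hσimage⟩ := h.exists_pairing
  set Q : Measure (ι → α) := Measure.pi fun _ => ξ with hQ
  have hAS : ∀ a ∈ A, a ∈ S := fun a ha => h.union ▸ Finset.mem_union_left _ ha
  have hBS : ∀ b ∈ B, b ∈ S := fun b hb => h.union ▸ Finset.mem_union_right _ hb
  have hAB : ∀ a ∈ A, ∀ b ∈ B, a ≠ b := fun a ha b hb => Finset.disjoint_iff_ne.1 h.disjoint a ha b hb
  have hc : (0 : ℝ) < A.card := by exact_mod_cast h.card_pos
  let Δ : ι → (ι → α) → E := fun a q => G (q a) - G (q (σ a))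
  have hΔm : ∀ a, StronglyMeasurable (Δ a) := fun a =>
    (hG.comp_measurable (measurable_pi_apply a)).sub
      (hG.comp_measurable (measurable_pi_apply (σ a)))
  have hR' : ∀ᵐ q ∂(Q.restrict Ev), R q ≤ D ∧ ∀ a ∈ A, ‖Δ a q‖ ≤ R q := by
    filter_upwards [ae_restrict_of_ae hR, ae_restrict_mem hEv] with q hq hqE
    exact ⟨(hq hqE).1, fun a ha => (hq hqE).2 a (hAS a ha) _ (hBS _ (hσB a ha))⟩
  have hint : ∀ a ∈ A, ∀ b ∈ A, Integrable (fun q => inner ℝ (Δ a q) (Δ b q)) (Q.restrict Ev) := by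
    intro a ha b hb
    refine Integrable.of_bound ((hΔm a).inner (hΔm b)).aestronglyMeasurable (D * D) ?_
    filter_upwards [hR'] with q hq
    have h1 := (hq.2 a ha).trans hq.1
    have h2 := (hq.2 b hb).trans hq.1
    exact (norm_inner_le_norm _ _).trans
      (mul_le_mul h1 h2 (norm_nonneg _) ((norm_nonneg _).trans h1))
  have hoff : ∀ a ∈ A, ∀ b ∈ A, a ≠ b → ∫ q in Ev, inner ℝ (Δ a q) (Δ b q) ∂Q = 0 := by
    intro a ha b hb hab
    -- Exchanging a with its partner preserves the law restricted to Ev, reverses Δ a and fixes Δ b.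
    -- The integral of their inner product therefore equals its own negative.
    have hT := measurePreserving_comp_perm ξ (Equiv.swap a (σ a))
    set T : (ι → α) → (ι → α) := fun q => q ∘ Equiv.swap a (σ a) with hTdef
    have h1 : ∀ q, Δ a (T q) = -Δ a q := fun q => by simp [Δ, hTdef]
    have h2 : ∀ q, Δ b (T q) = Δ b q := fun q => by
      have e1 : Equiv.swap a (σ a) b = b :=
        Equiv.swap_apply_of_ne_of_ne hab.symm (hAB b hb _ (hσB a ha))
      have e2 : Equiv.swap a (σ a) (σ b) = σ b :=
        Equiv.swap_apply_of_ne_of_ne (hAB a ha _ (hσB b hb)).symm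
          fun e => hab (hσinj a ha b hb e.symm)
      simp [Δ, hTdef, e1, e2]
    have h3 : T ⁻¹' Ev =ᵐ[Q] Ev := by
      filter_upwards [hinv a (hAS a ha) _ (hBS _ (hσB a ha))] with q hq
      exact propext hq
    have hTR : MeasurePreserving T (Q.restrict Ev) (Q.restrict Ev) := by
      have := hT.restrict_preimage hEv
      rwa [Measure.restrict_congr_set h3] at this
    have h4 := integral_comp_of_measurePreserving hTR
      (φ := fun q => inner ℝ (Δ a q) (Δ b q)) ((hΔm a).inner (hΔm b)).aestronglyMeasurable
    simp only [h1, h2, inner_neg_left, integral_neg] at h4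
    linarith
  have hsum : ∀ q : ι → α, ∑ j, splitWeight S A B j • G (q j)
      = (1 / S.card : ℝ) • ∑ a ∈ A, Δ a q := fun q => by
    rw [sum_splitWeight_smul, ← hσimage, Finset.sum_image hσinj, ← Finset.sum_sub_distrib]
  have hkey : ∫ q in Ev, ‖∑ a ∈ A, Δ a q‖ ^ 2 ∂Q = ∫ q in Ev, ∑ a ∈ A, ‖Δ a q‖ ^ 2 ∂Q := by
    simp_rw [← real_inner_self_eq_norm_sq, sum_inner, inner_sum]
    rw [integral_finsetSum _ fun a ha => integrable_finsetSum _ fun b hb => hint a ha b hb,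
      integral_finsetSum _ fun a ha => hint a ha a ha]
    refine Finset.sum_congr rfl fun a ha => ?_
    rw [integral_finsetSum _ fun b hb => hint a ha b hb,
      Finset.sum_eq_single_of_mem a ha fun b hb hba => hoff a ha b hb hba.symm]
  have hi1 : Integrable (fun q => ‖∑ a ∈ A, Δ a q‖ ^ 2) (Q.restrict Ev) := by
    simp_rw [← real_inner_self_eq_norm_sq, sum_inner, inner_sum]
    exact integrable_finsetSum _ fun a ha => integrable_finsetSum _ fun b hb => hint a ha b hb
  have hi2 : Integrable (fun q => ∑ a ∈ A, ‖Δ a q‖ ^ 2) (Q.restrict Ev) := by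
    simp_rw [← real_inner_self_eq_norm_sq]
    exact integrable_finsetSum _ fun a ha => hint a ha a ha
  calc _ = ∫⁻ q in Ev, ENNReal.ofReal ((1 / S.card : ℝ) ^ 2 * ‖∑ a ∈ A, Δ a q‖ ^ 2) ∂Q := by
        refine lintegral_congr fun q => ?_
        rw [hsum, norm_smul, mul_pow, Real.norm_eq_abs, sq_abs]
    _ = ENNReal.ofReal (∫ q in Ev, (1 / S.card : ℝ) ^ 2 * ‖∑ a ∈ A, Δ a q‖ ^ 2 ∂Q) :=
        (ofReal_integral_eq_lintegral_ofReal (hi1.const_mul _)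
          (ae_of_all _ fun q => by positivity)).symm
    _ = ENNReal.ofReal (∫ q in Ev, (1 / S.card : ℝ) ^ 2 * ∑ a ∈ A, ‖Δ a q‖ ^ 2 ∂Q) := by
        rw [integral_const_mul, integral_const_mul, hkey]
    _ = ∫⁻ q in Ev, ENNReal.ofReal ((1 / S.card : ℝ) ^ 2 * ∑ a ∈ A, ‖Δ a q‖ ^ 2) ∂Q :=
        ofReal_integral_eq_lintegral_ofReal (hi2.const_mul _)
          (ae_of_all _ fun q => mul_nonneg (by positivity)
            (Finset.sum_nonneg fun _ _ => by positivity))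
    _ ≤ _ := by
        refine lintegral_mono_ae ?_
        filter_upwards [hR'] with q hq
        refine ENNReal.ofReal_le_ofReal ?_
        calc _ ≤ (1 / S.card : ℝ) ^ 2 * ∑ a ∈ A, R q ^ 2 := by
              gcongr with a ha
              exact hq.2 a ha
          _ ≤ R q ^ 2 / S.card := by
              rw [Finset.sum_const, nsmul_eq_mul, h.card_cast]
              have e : (1 / (2 * A.card : ℝ)) ^ 2 * (A.card * R q ^ 2)
                  = R q ^ 2 / (2 * A.card) / 2 := by field_simp
              rw [e]
              exact half_le_self (by positivity)

/-! ### A measurable choice of blocks -/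

/-- A choice of the blocks produced by the halving algorithm, as a function of the order relations
between the samples. -/
noncomputable def blocks {K : ℕ} [NeZero K] (m : ℕ)
    (r : Fin (2 ^ m) → Fin (2 ^ m) → Fin K → Prop) :
    ((d : ℕ) → (Fin d → Bool) → Finset (Fin (2 ^ m))) ×
      ((d : ℕ) → (Fin d → Bool) → Finset (Fin (2 ^ m))) :=
  open scoped Classical in
  if h : ∃ C : ((d : ℕ) → (Fin d → Bool) → Finset (Fin (2 ^ m))) ×
      ((d : ℕ) → (Fin d → Bool) → Finset (Fin (2 ^ m))),
      ∃ y t, Precedes y t = r ∧ IsHalving m y t C.1 C.2 then h.choose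
  else (fun _ _ => ∅, fun _ _ => ∅)

/-- The order relations between the outer samples. -/
def pattern {K N : ℕ} (q : Fin N → EuclideanSpace ℝ (Fin K) × ℝ) :
    Fin N → Fin N → Fin K → Prop :=
  Precedes (fun i => (q i).1) (fun i => (q i).2)

/-- The pattern takes finitely many values, so any quantity built from the blocks is measurable once
it is measurable for each fixed pattern. -/
lemma measurable_pattern {K N : ℕ} : Measurable (pattern (K := K) (N := N)) := by
  refine measurable_pi_iff.2 fun i => measurable_pi_iff.2 fun j => measurable_pi_iff.2 fun k => ?_
  have h1 : ∀ i, Measurable (fun q : Fin N → EuclideanSpace ℝ (Fin K) × ℝ => (q i).1 k) :=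
    fun i => by fun_prop
  have h2 : ∀ i, Measurable (fun q : Fin N → EuclideanSpace ℝ (Fin K) × ℝ => (q i).2) :=
    fun i => by fun_prop
  refine measurableSet_setOfPred.1 ?_
  exact (measurableSet_lt (h1 i) (h1 j)).union
    ((measurableSet_eq_fun (h1 i) (h1 j)).inter (measurableSet_le (h2 i) (h2 j)))

lemma measurableSet_tieFree {K N : ℕ} : MeasurableSet
    {q : Fin N → EuclideanSpace ℝ (Fin K) × ℝ | TieFree (fun i => (q i).1) (fun i => (q i).2)} := by
  have h1 : ∀ k i, Measurable (fun q : Fin N → EuclideanSpace ℝ (Fin K) × ℝ => (q i).1 k) :=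
    fun k i => by fun_prop
  have h2 : ∀ i, Measurable (fun q : Fin N → EuclideanSpace ℝ (Fin K) × ℝ => (q i).2) :=
    fun i => by fun_prop
  simp only [TieFree, Set.ofPred_forall]
  refine .iInter fun i => .iInter fun j => .iInter fun _ => .iInter fun k => ?_
  simp only [imp_iff_not_or]
  exact (measurableSet_eq_fun (h1 k i) (h1 k j)).compl.union
    (measurableSet_eq_fun (h2 i) (h2 j)).compl

/-- The blocks of the outer samples `q`, sorted by coordinates. -/
noncomputable def blocksOf {K : ℕ} [NeZero K] {m : ℕ}
    (q : Fin (2 ^ m) → EuclideanSpace ℝ (Fin K) × ℝ) :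
    (d : ℕ) → (Fin d → Bool) → Finset (Fin (2 ^ m)) := (blocks m (pattern q)).1

/-- The blocks of the outer samples `q`, split by index. -/
noncomputable def blocksOf' {K : ℕ} [NeZero K] {m : ℕ}
    (q : Fin (2 ^ m) → EuclideanSpace ℝ (Fin K) × ℝ) :
    (d : ℕ) → (Fin d → Bool) → Finset (Fin (2 ^ m)) := (blocks m (pattern q)).2

/-- The outer samples `q` have no ties and the halving algorithm can be run. -/
def IsHalvable {K : ℕ} [NeZero K] {m : ℕ} (q : Fin (2 ^ m) → EuclideanSpace ℝ (Fin K) × ℝ) : Prop :=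
  TieFree (fun i => (q i).1) (fun i => (q i).2) ∧
    IsHalving m (fun i => (q i).1) (fun i => (q i).2) (blocksOf q) (blocksOf' q)

/-- The existence of a halving is taken from a given run. The chosen blocks may stem from other
samples with the same pattern, and `IsHalving.congr` carries them back. -/
lemma isHalving_blocksOf {K : ℕ} [NeZero K] {m : ℕ}
    {q : Fin (2 ^ m) → EuclideanSpace ℝ (Fin K) × ℝ}
    {B B' : (d : ℕ) → (Fin d → Bool) → Finset (Fin (2 ^ m))}
    (h : IsHalving m (fun i => (q i).1) (fun i => (q i).2) B B') :
    IsHalving m (fun i => (q i).1) (fun i => (q i).2) (blocksOf q) (blocksOf' q) := by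
  have hex : ∃ C : ((d : ℕ) → (Fin d → Bool) → Finset (Fin (2 ^ m))) ×
      ((d : ℕ) → (Fin d → Bool) → Finset (Fin (2 ^ m))),
      ∃ y t, Precedes y t = pattern q ∧ IsHalving m y t C.1 C.2 :=
    ⟨(B, B'), _, _, rfl, h⟩
  have hb : blocks m (pattern q) = hex.choose := by
    unfold blocks
    rw [dif_pos hex]
  obtain ⟨y, t, h1, h2⟩ := hex.choose_spec
  rw [blocksOf, blocksOf', hb]
  exact h2.congr h1

lemma measurableSet_blocks {K : ℕ} [NeZero K] {m : ℕ}
    (s : Set (Fin (2 ^ m) → Fin (2 ^ m) → Fin K → Prop)) :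
    MeasurableSet (pattern (K := K) (N := 2 ^ m) ⁻¹' s) :=
  measurable_pattern s.toFinite.measurableSet

lemma measurable_prod_pattern {K N : ℕ} {α β : Type*} [MeasurableSpace α] [MeasurableSpace β]
    (F : (Fin N → Fin N → Fin K → Prop) → α → β) (hF : ∀ r, Measurable (F r)) :
    Measurable (fun p : α × (Fin N → EuclideanSpace ℝ (Fin K) × ℝ) => F (pattern p.2) p.1) :=
  (measurable_from_prod_countable_left (f := fun p => F p.2 p.1) hF).comp
    (measurable_fst.prodMk (measurable_pattern.comp measurable_snd))

lemma measurable_of_pattern {K N : ℕ} {β : Type*} [MeasurableSpace β]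
    (F : (Fin N → Fin N → Fin K → Prop) → (Fin N → EuclideanSpace ℝ (Fin K) × ℝ) → β)
    (hF : ∀ r, Measurable (F r)) : Measurable (fun q => F (pattern q) q) :=
  (measurable_prod_pattern F hF).comp (measurable_id.prodMk measurable_id)

/-! ### Mean squared half differences at one level -/

section Level

variable {K m : ℕ} [NeZero K]

lemma IsHalving.isSplit {y : Fin (2 ^ m) → EuclideanSpace ℝ (Fin K)} {t : Fin (2 ^ m) → ℝ}
    {B B' : (d : ℕ) → (Fin d → Bool) → Finset (Fin (2 ^ m))} (h : IsHalving m y t B B') {d : ℕ}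
    (hd : d < m) (u : Fin d → Bool) :
    IsSplit (B d u) (B' (d + 1) (append u false)) (B' (d + 1) (append u true)) where
  union := h.union' d hd u
  disjoint := h.disjoint' d hd u
  card := by rw [h.card' d hd, h.card' d hd]
  nonempty := Finset.card_pos.1 (by rw [h.card_eq hd.le]; positivity)

/-- Half the difference between the means of `g` over the two halves, split by index, of the
block `u`. -/
noncomputable def halfDiff {E : Type*} [AddCommGroup E] [Module ℝ E]
    (g : EuclideanSpace ℝ (Fin K) → E) (q : Fin (2 ^ m) → EuclideanSpace ℝ (Fin K) × ℝ) {d : ℕ}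
    (u : Fin d → Bool) : E :=
  ∑ j, splitWeight (blocksOf q d u) (blocksOf' q (d + 1) (append u false))
    (blocksOf' q (d + 1) (append u true)) j • g (q j).1

variable {E : Type*} [NormedAddCommGroup E] [InnerProductSpace ℝ E]

lemma measurable_norm_sq_halfDiff {g : EuclideanSpace ℝ (Fin K) → E} (hg : StronglyMeasurable g)
    {d : ℕ} (u : Fin d → Bool) :
    Measurable (fun q : Fin (2 ^ m) → EuclideanSpace ℝ (Fin K) × ℝ => ‖halfDiff g q u‖ ^ 2) := by
  have hc : ∀ c : Fin (2 ^ m) → ℝ, Measurable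
      (fun q : Fin (2 ^ m) → EuclideanSpace ℝ (Fin K) × ℝ => ‖∑ j, c j • g (q j).1‖ ^ 2) := by
    intro c
    have h1 : ∀ j, StronglyMeasurable
        (fun q : Fin (2 ^ m) → EuclideanSpace ℝ (Fin K) × ℝ => c j • g (q j).1) := fun j =>
      (hg.comp_measurable (measurable_fst.comp (measurable_pi_apply j))).const_smul (c j)
    exact (Finset.stronglyMeasurable_fun_sum Finset.univ fun j _ => h1 j).norm.measurable.pow_const 2
  exact measurable_of_pattern (fun r q => ‖∑ j, splitWeight ((blocks m r).1 d u)
    ((blocks m r).2 (d + 1) (append u false)) ((blocks m r).2 (d + 1) (append u true)) j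
      • g (q j).1‖ ^ 2) fun r => hc _

/-- The sample space is partitioned according to which set S the block `u` is. On each piece S and
its index halves are fixed, so the exchange argument applies; summing the pieces leaves the mean
squared radius of the blocks. -/
lemma lintegral_halfDiff_le (ξ : Measure (EuclideanSpace ℝ (Fin K) × ℝ)) [IsProbabilityMeasure ξ]
    (hreg : ∀ᵐ q ∂(Measure.pi fun _ : Fin (2 ^ m) => ξ), IsHalvable q)
    {g : EuclideanSpace ℝ (Fin K) → E} (hg : StronglyMeasurable g) {T : Fin K → ℝ → ℝ}
    (hT : ∀ k s, T k s ∈ Set.Icc (0 : ℝ) 1) (hmono : ∀ k, Monotone (T k)) {β : ℝ} (hβ : 0 ≤ β)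
    (hlip : ∀ᵐ q ∂(Measure.pi fun _ : Fin (2 ^ m) => ξ), ∀ i j, ‖g (q i).1 - g (q j).1‖
      ≤ β * ‖coordMap T (q i).1 - coordMap T (q j).1‖) {d : ℕ} (hd : d < m) :
    ∫⁻ q, ENNReal.ofReal ((1 / 2 ^ d : ℝ) * ∑ u : Fin d → Bool, ‖halfDiff g q u‖ ^ 2)
        ∂(Measure.pi fun _ : Fin (2 ^ m) => ξ)
      ≤ ENNReal.ofReal (β ^ 2 * (K * (1 / 2) ^ (d / K)) / 2 ^ (m - d)) := by
  set Q := Measure.pi fun _ : Fin (2 ^ m) => ξ with hQ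
  have hr : ∀ q : Fin (2 ^ m) → EuclideanSpace ℝ (Fin K) × ℝ, ∃ r : (Fin d → Bool) → ℝ,
      IsHalvable q →
      (∀ u, ∀ i ∈ blocksOf q d u, ∀ j ∈ blocksOf q d u,
        ‖coordMap T (q i).1 - coordMap T (q j).1‖ ≤ r u) ∧
      (∀ u, 0 ≤ r u ∧ r u ^ 2 ≤ K) ∧
      (1 / 2 ^ d : ℝ) * ∑ u, r u ^ 2 ≤ K * (1 / 2) ^ (d / K) := fun q => by
    by_cases hq : IsHalvable q
    · obtain ⟨r, hr⟩ := hq.2.exists_diam hT hmono hd.le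
      exact ⟨r, fun _ => hr⟩
    · exact ⟨fun _ => 0, fun h => absurd h hq⟩
  -- The radii depend on q with no claim of measurability; only integrals of upper bounds in r are
  -- used.
  choose r hr using hr
  have hblock : ∀ (u : Fin d → Bool) (S : Finset (Fin (2 ^ m))),
      ∫⁻ q in {q | blocksOf q d u = S}, ENNReal.ofReal (‖halfDiff g q u‖ ^ 2) ∂Q
        ≤ ∫⁻ q in {q | blocksOf q d u = S}, ENNReal.ofReal ((β * r q u) ^ 2 / 2 ^ (m - d)) ∂Q := by
    intro u S
    have hEv : MeasurableSet {q : Fin (2 ^ m) → EuclideanSpace ℝ (Fin K) × ℝ | blocksOf q d u = S} :=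
      measurableSet_blocks {p | (blocks m p).1 d u = S}
    -- A halvable reference point q₀ supplies the split of S. If there is none, the event is null.
    -- Since index halves depend only on their parent, those of q₀ serve every halvable q in the
    -- event.
    by_cases hne : ∃ q₀ : Fin (2 ^ m) → EuclideanSpace ℝ (Fin K) × ℝ,
        IsHalvable q₀ ∧ blocksOf q₀ d u = S
    swap
    · have h0 : Q {q | blocksOf q d u = S} = 0 := by
        refine measure_mono_null (fun q hq hq' => hne ⟨q, hq', hq⟩) hreg
      rw [Measure.restrict_eq_zero.2 h0]
      simp
    obtain ⟨q₀, hq₀, hS⟩ := hne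
    have hsplit := hq₀.2.isSplit hd u
    have hcard := hq₀.2.card_eq hd.le u
    rw [hS] at hsplit hcard
    have hswap : ∀ a ∈ S, ∀ b ∈ S, ∀ᵐ q ∂Q,
        q ∘ Equiv.swap a b ∈ {q | blocksOf q d u = S} ↔ q ∈ {q | blocksOf q d u = S} := by
      intro a ha b hb
      filter_upwards [hreg, (measurePreserving_comp_perm ξ
        (Equiv.swap a b)).quasiMeasurePreserving.ae hreg] with q hq hq'
      constructor
      · intro h
        -- A swap is an involution, so q is itself a swap of the swapped samples and
        -- `IsHalving.eq_of_swap` also gives this direction.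
        have hinv : (q ∘ Equiv.swap a b) ∘ Equiv.swap a b = q := by
          funext i; simp
        have hq2 := hq
        rw [← hinv] at hq2
        have := hq'.2.eq_of_swap hq'.1 (a := a) (b := b) hq2.2 hd.le (u := u) (by rwa [h])
          (by rwa [h])
        rw [hinv] at this
        exact this.trans h
      · intro h
        exact (hq.2.eq_of_swap hq.1 (a := a) (b := b) hq'.2 hd.le (u := u) (by rwa [h])
          (by rwa [h])).trans h
    have hR : ∀ᵐ q ∂Q, q ∈ {q | blocksOf q d u = S} → β * r q u ≤ β * √K ∧
        ∀ i ∈ S, ∀ j ∈ S, ‖g (q i).1 - g (q j).1‖ ≤ β * r q u := by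
      filter_upwards [hreg, hlip] with q hq hl hqS
      obtain ⟨h1, h2, -⟩ := hr q hq
      refine ⟨mul_le_mul_of_nonneg_left (Real.le_sqrt_of_sq_le (h2 u).2) hβ, fun i hi j hj => ?_⟩
      exact (hl i j).trans (mul_le_mul_of_nonneg_left
        (h1 u i (by rwa [hqS]) j (by rwa [hqS])) hβ)
    have hmain := hsplit.setLIntegral_sum_weight_le ξ
      (hg.comp_measurable measurable_fst) hEv hswap hR
    rw [hcard] at hmain
    push_cast at hmain
    refine le_trans (le_of_eq ?_) hmain
    refine lintegral_congr_ae ?_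
    filter_upwards [ae_restrict_of_ae hreg, ae_restrict_mem hEv] with q hq hqS
    obtain ⟨h1, h2⟩ := hq.2.index_halves_eq hq₀.2 hd (u := u) (hqS.trans hS.symm)
    rw [halfDiff, h1, h2, hqS]
    rfl
  have hlevel : ∀ u : Fin d → Bool, ∫⁻ q, ENNReal.ofReal (‖halfDiff g q u‖ ^ 2) ∂Q
      ≤ ∫⁻ q, ENNReal.ofReal ((β * r q u) ^ 2 / 2 ^ (m - d)) ∂Q := by
    intro u
    have hpart : ∀ φ : (Fin (2 ^ m) → EuclideanSpace ℝ (Fin K) × ℝ) → ℝ≥0∞,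
        ∫⁻ q, φ q ∂Q = ∑ S : Finset (Fin (2 ^ m)), ∫⁻ q in {q | blocksOf q d u = S}, φ q ∂Q := by
      intro φ
      have hU := lintegral_iUnion (μ := Q)
        (s := fun S => {q : Fin (2 ^ m) → EuclideanSpace ℝ (Fin K) × ℝ | blocksOf q d u = S})
        (fun S => measurableSet_blocks {p | (blocks m p).1 d u = S})
        (fun S S' hne => Set.disjoint_left.2 fun q h h' => hne (h.symm.trans h')) φ
      rw [← tsum_fintype (L := .unconditional _), ← hU]
      have : (⋃ S, {q : Fin (2 ^ m) → EuclideanSpace ℝ (Fin K) × ℝ | blocksOf q d u = S})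
          = Set.univ := Set.eq_univ_of_forall fun q => Set.mem_iUnion.2 ⟨_, rfl⟩
      rw [this, Measure.restrict_univ]
    rw [hpart, hpart]
    exact Finset.sum_le_sum fun S _ => hblock u S
  calc _ = ENNReal.ofReal (1 / 2 ^ d : ℝ) *
        ∑ u : Fin d → Bool, ∫⁻ q, ENNReal.ofReal (‖halfDiff g q u‖ ^ 2) ∂Q := by
        rw [← lintegral_finsetSum _ fun u _ => (measurable_norm_sq_halfDiff hg u).ennreal_ofReal,
          ← lintegral_const_mul _ (Finset.measurable_sum _ fun u _ =>
            (measurable_norm_sq_halfDiff hg u).ennreal_ofReal)]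
        refine lintegral_congr fun q => ?_
        rw [ENNReal.ofReal_mul (by positivity), ENNReal.ofReal_sum_of_nonneg
          fun u _ => by positivity]
    _ ≤ ENNReal.ofReal (1 / 2 ^ d : ℝ) * ∫⁻ q, ∑ u : Fin d → Bool,
        ENNReal.ofReal ((β * r q u) ^ 2 / 2 ^ (m - d)) ∂Q := by
        gcongr
        exact (Finset.sum_le_sum fun u _ => hlevel u).trans (sum_lintegral_le _ _ _)
    _ = ∫⁻ q, ENNReal.ofReal (β ^ 2 * ((1 / 2 ^ d : ℝ) * ∑ u, r q u ^ 2) / 2 ^ (m - d)) ∂Q := by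
        rw [← lintegral_const_mul' _ _ ENNReal.ofReal_ne_top]
        refine lintegral_congr fun q => ?_
        rw [← ENNReal.ofReal_sum_of_nonneg fun u _ => by positivity,
          ← ENNReal.ofReal_mul (by positivity)]
        congr 1
        simp only [mul_pow, ← Finset.sum_div, ← Finset.mul_sum]
        ring
    _ ≤ ∫⁻ _, ENNReal.ofReal (β ^ 2 * (K * (1 / 2) ^ (d / K)) / 2 ^ (m - d)) ∂Q := by
        refine lintegral_mono_ae ?_
        filter_upwards [hreg] with q hq
        refine ENNReal.ofReal_le_ofReal ?_
        have := (hr q hq).2.2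
        gcongr
    _ = _ := by simp

end Level

lemma sq_mean_le {ι : Type*} (s : Finset ι) {n : ℝ} (hn : n = s.card) {z M : ι → ℝ}
    (h : ∀ i ∈ s, z i ^ 2 ≤ M i) : ((1 / n) * ∑ i ∈ s, z i) ^ 2 ≤ (1 / n) * ∑ i ∈ s, M i := by
  rcases s.eq_empty_or_nonempty with rfl | hs
  · simp
  have hpos : (0 : ℝ) < n := hn ▸ by exact_mod_cast Finset.card_pos.2 hs
  have h1 := sq_sum_le_card_mul_sum_sq (s := s) (f := z)
  have h2 := Finset.sum_le_sum h
  rw [← hn] at h1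
  calc ((1 / n) * ∑ i ∈ s, z i) ^ 2 = (1 / n) ^ 2 * (∑ i ∈ s, z i) ^ 2 := by ring
    _ ≤ (1 / n) ^ 2 * (n * ∑ i ∈ s, M i) := by gcongr; exact h1.trans (by gcongr)
    _ = (1 / n) * ∑ i ∈ s, M i := by field_simp

lemma continuous_of_abs_sub_le {E : Type*} [NormedAddCommGroup E] {f : E → ℝ} {α₁ : ℝ}
    (hf₁ : ∀ x y, |f x - f (x + y)| ≤ α₁ * ‖y‖) : Continuous f := by
  rw [continuous_iff_continuousAt]
  intro x
  refine tendsto_iff_norm_sub_tendsto_zero.2 ?_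
  have h0 : Filter.Tendsto (fun x' => α₁ * ‖x' - x‖) (nhds x) (nhds 0) := by
    have : Continuous (fun x' : E => α₁ * ‖x' - x‖) := by fun_prop
    simpa using this.tendsto x
  refine squeeze_zero (fun _ => norm_nonneg _) (fun x' => ?_) h0
  have := hf₁ x (x' - x)
  rwa [add_sub_cancel, abs_sub_comm] at this

/-! ### Reference values for identically distributed samples -/

section Mean

variable {ι : Type*} [Fintype ι] {E : Type*} [NormedAddCommGroup E]
  [InnerProductSpace ℝ E] [MeasurableSpace E] [BorelSpace E] [SecondCountableTopology E] {f : E → ℝ}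
  {α₁ : ℝ}

lemma memLp_comp_blockMean (hα₁ : 0 ≤ α₁) (hf₁ : ∀ x y, |f x - f (x + y)| ≤ α₁ * ‖y‖)
    (μ : ι → Measure E) [∀ i, IsProbabilityMeasure (μ i)] (hμ : ∀ i, MemLp (fun x => x) 2 (μ i))
    (S : Finset ι) : MemLp (fun x => f (blockMean x S)) 2 (Measure.pi μ) := by
  classical
  refine memLp_of_abs_sub_le μ (fun _ => 0) (fun i => memLp_sub_const (hμ i) 0)
    (fun i => if i ∈ S then α₁ / S.card else 0) _ fun x x' => ?_
  refine (abs_blockMean_sub_le hα₁ hf₁ x x' S).trans_eq ?_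
  simp only [ite_mul, zero_mul, Finset.sum_ite_mem, Finset.univ_inter, ← Finset.mul_sum]

/-- A power of a single law is invariant under permutations, and any two index sets of equal size
are related by one. -/
lemma integral_comp_blockMean_congr (hf₁ : ∀ x y, |f x - f (x + y)| ≤ α₁ * ‖y‖) (lam : Measure E)
    [IsProbabilityMeasure lam] {S S' : Finset ι} (h : S.card = S'.card) :
    ∫ x, f (blockMean x S) ∂(Measure.pi fun _ => lam)
      = ∫ x, f (blockMean x S') ∂(Measure.pi fun _ => lam) := by
  obtain ⟨τ, rfl⟩ := Equiv.Perm.exists_map_finset_eq S S' h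
  have hmean : ∀ x : ι → E, blockMean (x ∘ τ) S = blockMean x (S.map τ.toEmbedding) := fun x => by
    rw [blockMean, blockMean, h, Finset.sum_map]
    rfl
  have hcont : Continuous fun x : ι → E => f (blockMean x S) := by
    have := continuous_of_abs_sub_le hf₁
    unfold blockMean
    fun_prop
  rw [← integral_comp_of_measurePreserving (measurePreserving_comp_perm lam τ)
    hcont.aestronglyMeasurable]
  simp only [hmean]

/-- The expectation of `f` of the mean of `c` independent samples of law `lam`, out of `N`. -/
noncomputable def sizeMean (N : ℕ) (f : E → ℝ) (lam : Measure E) (c : ℕ) : ℝ :=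
  ∫ x, f (blockMean x (Finset.univ.filter fun i : Fin N => i.val < c)) ∂(Measure.pi fun _ => lam)

lemma integral_comp_blockMean_eq {N : ℕ} (hf₁ : ∀ x y, |f x - f (x + y)| ≤ α₁ * ‖y‖)
    (lam : Measure E) [IsProbabilityMeasure lam] (S : Finset (Fin N)) :
    ∫ x, f (blockMean x S) ∂(Measure.pi fun _ => lam) = sizeMean N f lam S.card := by
  refine integral_comp_blockMean_congr hf₁ lam ?_
  rw [Fin.card_filter_val_lt, min_eq_right]
  simpa using Finset.card_le_univ S

/-- With a common law only the sizes of the block and of its halves matter. This makes the sum over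
the levels telescope. -/
lemma IsSplit.integral_splitDefect {N : ℕ} {S A B : Finset (Fin N)} (h : IsSplit S A B)
    (hα₁ : 0 ≤ α₁) (hf₁ : ∀ x y, |f x - f (x + y)| ≤ α₁ * ‖y‖) (lam : Measure E)
    [IsProbabilityMeasure lam] (hlam : MemLp (fun x => x) 2 lam) :
    ∫ x, splitDefect f x S A B ∂(Measure.pi fun _ => lam)
      = sizeMean N f lam S.card - sizeMean N f lam A.card := by
  have hi : ∀ S : Finset (Fin N), Integrable (fun x => f (blockMean x S))
      (Measure.pi fun _ : Fin N => lam) := fun S =>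
    (memLp_comp_blockMean hα₁ hf₁ _ (fun _ => hlam) S).integrable one_le_two
  have hi2 : Integrable (fun x => f (blockMean x S) - f (blockMean x A) / 2)
      (Measure.pi fun _ : Fin N => lam) := (hi S).sub ((hi A).div_const 2)
  unfold splitDefect
  rw [integral_sub hi2 ((hi B).div_const 2), integral_sub (hi S) ((hi A).div_const 2),
    integral_div, integral_div, integral_comp_blockMean_eq hf₁, integral_comp_blockMean_eq hf₁,
    integral_comp_blockMean_eq hf₁, ← h.card]
  ring

lemma sizeMean_one {N : ℕ} (hN : 0 < N) (hf₁ : ∀ x y, |f x - f (x + y)| ≤ α₁ * ‖y‖)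
    (lam : Measure E) [IsProbabilityMeasure lam] : sizeMean N f lam 1 = ∫ x, f x ∂lam := by
  have h := integral_comp_blockMean_eq hf₁ lam {(⟨0, hN⟩ : Fin N)}
  rw [Finset.card_singleton] at h
  rw [← h]
  simp only [blockMean, Finset.card_singleton, Finset.sum_singleton, Nat.cast_one, div_one,
    one_smul]
  exact integral_comp_eval (μ := fun _ : Fin N => lam) (i := ⟨0, hN⟩)
    (continuous_of_abs_sub_le hf₁).aestronglyMeasurable

/-- The bias of `f` of the mean of `N` samples. -/
lemma sq_sizeMean_sub_le [CompleteSpace E] {N : ℕ} (hN : 0 < N) (hα₁ : 0 ≤ α₁)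
    (hf₁ : ∀ x y, |f x - f (x + y)| ≤ α₁ * ‖y‖)
    (lam : Measure E) [IsProbabilityMeasure lam] (hlam : MemLp (fun x => x) 2 lam) {V : ℝ}
    (hV : ∫ x, ‖x - ∫ x', x' ∂lam‖ ^ 2 ∂lam ≤ V) :
    (sizeMean N f lam N - f (∫ x, x ∂lam)) ^ 2 ≤ α₁ ^ 2 * V / N := by
  set c := ∫ x, x ∂lam with hc
  have h := integral_comp_blockMean_eq hf₁ lam (Finset.univ : Finset (Fin N))
  rw [Finset.card_univ, Fintype.card_fin] at h
  rw [← h]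
  have hN' : (0 : ℝ) < N := by exact_mod_cast hN
  set Q : Measure (Fin N → E) := Measure.pi fun _ => lam with hQ
  have hL := memLp_comp_blockMean hα₁ hf₁ (fun _ : Fin N => lam) (fun _ => hlam) Finset.univ
  have hmean : ∀ x : Fin N → E, blockMean x Finset.univ - c = ∑ i, (1 / N : ℝ) • (x i - c) :=
    fun x => by
      rw [blockMean, Finset.card_univ, Fintype.card_fin, ← Finset.smul_sum,
        Finset.sum_sub_distrib, smul_sub, Finset.sum_const, Finset.card_univ, Fintype.card_fin,
        ← Nat.cast_smul_eq_nsmul ℝ, smul_smul, one_div_mul_cancel hN'.ne', one_smul]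
  have hv : MemLp (fun x => (1 / N : ℝ) • (x - c)) 2 lam := (memLp_sub_const hlam c).const_smul _
  have h2 := integral_norm_sq_sum_pi_le (fun _ : Fin N => lam)
    (fun _ x => (1 / N : ℝ) • (x - c)) (fun _ => hv)
  have h3 : ∫ x, (1 / N : ℝ) • (x - c) ∂lam = 0 := by
    rw [integral_smul, integral_sub (hlam.integrable one_le_two) (integrable_const _), ← hc]
    simp
  have h4 : ∫ x, ‖(1 / N : ℝ) • (x - c)‖ ^ 2 ∂lam ≤ (1 / N : ℝ) ^ 2 * V := by
    simp only [norm_smul, mul_pow, Real.norm_eq_abs, sq_abs]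
    rw [integral_const_mul]
    gcongr
  have h5 : ∫ x, ‖blockMean x Finset.univ - c‖ ^ 2 ∂Q ≤ V / N := by
    simp only [hmean]
    refine h2.trans ?_
    simp only [h3, Finset.sum_const_zero, norm_zero, Finset.sum_const, Finset.card_univ,
      Fintype.card_fin, nsmul_eq_mul]
    calc _ ≤ N * ((1 / N : ℝ) ^ 2 * V) + 0 ^ 2 := by gcongr
      _ = V / N := by field_simp; ring
  have h6 : MemLp (fun x => f (blockMean x Finset.univ) - f c) 2 Q := hL.sub (memLp_const _)
  have h7 := variance_eq_sub h6
  have h8 := variance_nonneg (fun x => f (blockMean x Finset.univ) - f c) Q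
  have h9 : ∫ x, (f (blockMean x Finset.univ) - f c) ∂Q
      = ∫ x, f (blockMean x Finset.univ) ∂Q - f c := by
    rw [integral_sub (hL.integrable one_le_two) (integrable_const _), integral_const,
      probReal_univ, one_smul]
  have h10 : ∫ x, (f (blockMean x Finset.univ) - f c) ^ 2 ∂Q
      ≤ ∫ x, α₁ ^ 2 * ‖blockMean x Finset.univ - c‖ ^ 2 ∂Q := by
    refine integral_mono h6.integrable_sq (Integrable.const_mul ?_ _) fun x => ?_
    · simp only [hmean]
      refine MemLp.integrable_sq (f := fun x : Fin N → E => ‖∑ i, (1 / N : ℝ) • (x i - c)‖) ?_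
      exact (memLp_finsetSum _ fun i _ => hv.comp_measurePreserving
        (measurePreserving_eval (fun _ : Fin N => lam) i)).norm
    · have := hf₁ c (blockMean x Finset.univ - c)
      rw [add_sub_cancel, abs_sub_comm] at this
      have := pow_le_pow_left₀ (abs_nonneg _) this 2
      rwa [sq_abs, mul_pow] at this
  rw [integral_const_mul] at h10
  simp only [Pi.pow_apply] at h7
  rw [h9] at h7
  calc _ ≤ α₁ ^ 2 * ∫ x, ‖blockMean x Finset.univ - c‖ ^ 2 ∂Q := by linarith
    _ ≤ α₁ ^ 2 * (V / N) := by gcongr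
    _ = _ := by ring

end Mean

/-! ### Conditional bias and variance given the outer samples -/

section Conditional

variable {J K m : ℕ} [NeZero K] {f : EuclideanSpace ℝ (Fin J) → ℝ} {α₁ α₂ : ℝ}
  (κ : Fin (2 ^ m) → Measure (EuclideanSpace ℝ (Fin J))) [∀ i, IsProbabilityMeasure (κ i)]

/-- The antithetic difference of `f` over the block `u` of the outer samples `q`. -/
noncomputable def blockDefect (f : EuclideanSpace ℝ (Fin J) → ℝ)
    (q : Fin (2 ^ m) → EuclideanSpace ℝ (Fin K) × ℝ) {d : ℕ} (u : Fin d → Bool)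
    (x : Fin (2 ^ m) → EuclideanSpace ℝ (Fin J)) : ℝ :=
  splitDefect f x (blocksOf q d u) (blocksOf' q (d + 1) (append u false))
    (blocksOf' q (d + 1) (append u true))

/-- The error made at level `d` by replacing the conditional laws of all inner samples of a block
by the conditional law of one of them, averaged over the samples and the blocks. -/
noncomputable def levelBias (f : EuclideanSpace ℝ (Fin J) → ℝ)
    (q : Fin (2 ^ m) → EuclideanSpace ℝ (Fin K) × ℝ) (d : ℕ) : ℝ :=
  (1 / 2 ^ d : ℝ) * ∑ u : Fin d → Bool, (1 / 2 ^ (m - d) : ℝ) * ∑ i ∈ blocksOf q d u,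
    (∫ x, blockDefect f q u x ∂(Measure.pi κ)
      - ∫ x, blockDefect f q u x ∂(Measure.pi fun _ => κ i))

variable {κ}

/-- Every member i of a block serves as the common law, with δ equal to β times the block radius.
Cauchy–Schwarz, first over i and then over the blocks, leaves the mean squared radius bounded by
`IsHalving.exists_diam` and the half differences, which are controlled only after averaging over q.
-/
lemma sq_levelBias_le (hα₁ : 0 ≤ α₁) (hα₂ : 0 ≤ α₂)
    (hf₁ : ∀ x y, |f x - f (x + y)| ≤ α₁ * ‖y‖)
    (hf₂ : ∀ x y y', |f x - f (x + y) - f (x + y') + f (x + y + y')| ≤ α₂ * ‖y‖ * ‖y'‖)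
    {T : Fin K → ℝ → ℝ} (hT : ∀ k s, T k s ∈ Set.Icc (0 : ℝ) 1) (hmono : ∀ k, Monotone (T k))
    {β V : ℝ} (hβ : 0 ≤ β) {q : Fin (2 ^ m) → EuclideanSpace ℝ (Fin K) × ℝ} (hq : IsHalvable q)
    {g : EuclideanSpace ℝ (Fin K) → EuclideanSpace ℝ (Fin J)}
    (hg : ∀ i, ∫ x, x ∂(κ i) = g (q i).1) (hκ : ∀ i, MemLp (fun x => x) 2 (κ i))
    (hV : ∀ i, ∫ x, ‖x - ∫ x', x' ∂(κ i)‖ ^ 2 ∂(κ i) ≤ V)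
    (hγ : ∀ i j, ∃ γ : Measure (EuclideanSpace ℝ (Fin J) × EuclideanSpace ℝ (Fin J)),
      γ.fst = κ i ∧ γ.snd = κ j ∧
        ∀ᵐ p ∂γ, ‖p.1 - p.2‖ ≤ β * ‖coordMap T (q i).1 - coordMap T (q j).1‖)
    {d : ℕ} (hd : d < m) :
    levelBias κ f q d ^ 2 ≤ α₂ ^ 2 * (8 * V + β ^ 2 * K) *
      (β ^ 2 * (K * (1 / 2) ^ (d / K)) / 2 ^ (m - d)
        + (1 / 2 ^ d : ℝ) * ∑ u : Fin d → Bool, ‖halfDiff g q u‖ ^ 2) := by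
  obtain ⟨r, hr1, hr2, hr3⟩ := hq.2.exists_diam hT hmono hd.le
  have hV0 : 0 ≤ V := (integral_nonneg fun x => by positivity).trans (hV ⟨0, by positivity⟩)
  have hcard : ∀ u : Fin d → Bool, (2 ^ (m - d) : ℝ) = (blocksOf q d u).card := fun u => by
    rw [hq.2.card_eq hd.le u]; push_cast; rfl
  have hsample : ∀ u : Fin d → Bool, ∀ i ∈ blocksOf q d u,
      (∫ x, blockDefect f q u x ∂(Measure.pi κ)
        - ∫ x, blockDefect f q u x ∂(Measure.pi fun _ => κ i)) ^ 2
      ≤ α₂ ^ 2 * (8 * V + β ^ 2 * K) * ((β * r u) ^ 2 / 2 ^ (m - d) + ‖halfDiff g q u‖ ^ 2) := by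
    intro u i hi
    have h := (hq.2.isSplit hd u).sq_integral_splitDefect_sub_le hα₁ hα₂ hf₁ hf₂ κ (κ i) hκ (hκ i)
      (hV i) (δ := β * r u) (D := β ^ 2 * K) (mul_nonneg hβ (hr2 u).1)
      (by rw [mul_pow]; exact mul_le_mul_of_nonneg_left (hr2 u).2 (sq_nonneg β))
      (fun j hj => by
        obtain ⟨γ, h1, h2, h3⟩ := hγ j i
        refine ⟨γ, h1, h2, h3.mono fun p hp => hp.trans ?_⟩
        exact mul_le_mul_of_nonneg_left (hr1 u j hj i hi) hβ)
    rw [← hcard u] at h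
    simp only [hg] at h
    exact h
  have hblock : ∀ u : Fin d → Bool, ((1 / 2 ^ (m - d) : ℝ) * ∑ i ∈ blocksOf q d u,
      (∫ x, blockDefect f q u x ∂(Measure.pi κ)
        - ∫ x, blockDefect f q u x ∂(Measure.pi fun _ => κ i))) ^ 2
      ≤ α₂ ^ 2 * (8 * V + β ^ 2 * K) * ((β * r u) ^ 2 / 2 ^ (m - d) + ‖halfDiff g q u‖ ^ 2) := by
    intro u
    refine (sq_mean_le _ (hcard u) (hsample u)).trans_eq ?_
    rw [Finset.sum_const, nsmul_eq_mul, ← hcard u]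
    field_simp
  refine (sq_mean_le (Finset.univ : Finset (Fin d → Bool)) (n := 2 ^ d) (by simp)
    (fun u _ => hblock u)).trans ?_
  rw [← Finset.mul_sum, mul_left_comm, Finset.sum_add_distrib,
    mul_add (1 / 2 ^ d : ℝ)]
  have e : (1 / 2 ^ d : ℝ) * ∑ u : Fin d → Bool, (β * r u) ^ 2 / 2 ^ (m - d)
      = β ^ 2 * ((1 / 2 ^ d : ℝ) * ∑ u, r u ^ 2) / 2 ^ (m - d) := by
    simp only [mul_pow, ← Finset.sum_div, ← Finset.mul_sum]
    ring
  rw [e]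
  gcongr

lemma memLp_blockDefect (hα₁ : 0 ≤ α₁) (hf₁ : ∀ x y, |f x - f (x + y)| ≤ α₁ * ‖y‖)
    {q : Fin (2 ^ m) → EuclideanSpace ℝ (Fin K) × ℝ} (hq : IsHalvable q)
    (hκ : ∀ i, MemLp (fun x => x) 2 (κ i)) {d : ℕ} (hd : d < m) (u : Fin d → Bool) :
    MemLp (blockDefect f q u) 2 (Measure.pi κ) :=
  memLp_of_abs_sub_le κ (fun _ => 0) (fun i => memLp_sub_const (hκ i) 0) _ _
    ((hq.2.isSplit hd u).abs_splitDefect_sub_le hα₁ hf₁)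

lemma estimator_blocksOf (f : EuclideanSpace ℝ (Fin J) → ℝ)
    {q : Fin (2 ^ m) → EuclideanSpace ℝ (Fin K) × ℝ} (hq : IsHalvable q)
    (x : Fin (2 ^ m) → EuclideanSpace ℝ (Fin J)) :
    estimator m f x (blocksOf q) (blocksOf' q) = (1 / 2 ^ m : ℝ) * ∑ i, f (x i)
      + ∑ d ∈ Finset.range m, (1 / 2 ^ d : ℝ) * ∑ u : Fin d → Bool, blockDefect f q u x :=
  hq.2.estimator_eq f x

/-- At each level d < m a sample lies in one block, with weight 2^(-d)·2α₁/2^(m-d) = 2α₁/2^m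
whatever d is. The m levels and the leaf term α₁/2^m give the factor 2m + 1. -/
lemma abs_estimator_sub_le (hα₁ : 0 ≤ α₁) (hf₁ : ∀ x y, |f x - f (x + y)| ≤ α₁ * ‖y‖)
    {q : Fin (2 ^ m) → EuclideanSpace ℝ (Fin K) × ℝ} (hq : IsHalvable q)
    (x x' : Fin (2 ^ m) → EuclideanSpace ℝ (Fin J)) :
    |estimator m f x (blocksOf q) (blocksOf' q) - estimator m f x' (blocksOf q) (blocksOf' q)|
      ≤ ∑ i, ((2 * m + 1) * α₁ / 2 ^ m) * ‖x i - x' i‖ := by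
  rw [estimator_blocksOf f hq, estimator_blocksOf f hq, add_sub_add_comm, ← mul_sub,
    ← Finset.sum_sub_distrib, ← Finset.sum_sub_distrib]
  have h1 : |(1 / 2 ^ m : ℝ) * ∑ i, (f (x i) - f (x' i))|
      ≤ α₁ / 2 ^ m * ∑ i, ‖x i - x' i‖ := by
    rw [abs_mul, abs_of_nonneg (by positivity : (0 : ℝ) ≤ 1 / 2 ^ m), div_mul_eq_mul_div, one_mul,
      div_mul_eq_mul_div, Finset.mul_sum]
    gcongr
    refine (Finset.abs_sum_le_sum_abs _ _).trans (Finset.sum_le_sum fun i _ => ?_)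
    have := hf₁ (x' i) (x i - x' i)
    rwa [add_sub_cancel, abs_sub_comm] at this
  have h2 : ∀ d ∈ Finset.range m, |(1 / 2 ^ d : ℝ) * ∑ u : Fin d → Bool, blockDefect f q u x
      - (1 / 2 ^ d : ℝ) * ∑ u : Fin d → Bool, blockDefect f q u x'|
      ≤ 2 * α₁ / 2 ^ m * ∑ i, ‖x i - x' i‖ := by
    intro d hd
    rw [Finset.mem_range] at hd
    rw [← mul_sub, ← Finset.sum_sub_distrib, abs_mul,
      abs_of_nonneg (by positivity : (0 : ℝ) ≤ 1 / 2 ^ d)]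
    have h3 : ∀ u : Fin d → Bool, |blockDefect f q u x - blockDefect f q u x'|
        ≤ 2 * α₁ / 2 ^ (m - d) * ∑ i ∈ blocksOf q d u, ‖x i - x' i‖ := fun u => by
      refine ((hq.2.isSplit hd u).abs_splitDefect_sub_le hα₁ hf₁ x x').trans_eq ?_
      simp only [ite_mul, zero_mul, Finset.sum_ite_mem, Finset.univ_inter, ← Finset.mul_sum,
        hq.2.card_eq hd.le u]
      push_cast
      rfl
    calc _ ≤ (1 / 2 ^ d : ℝ) * ∑ u : Fin d → Bool,
          2 * α₁ / 2 ^ (m - d) * ∑ i ∈ blocksOf q d u, ‖x i - x' i‖ := by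
          gcongr
          exact (Finset.abs_sum_le_sum_abs _ _).trans (Finset.sum_le_sum fun u _ => h3 u)
      _ = _ := by
          rw [← Finset.mul_sum, hq.2.sum_blocks hd.le, ← mul_assoc]
          congr 1
          rw [← pow_sub_mul_pow (2 : ℝ) hd.le]
          field_simp
  calc _ ≤ α₁ / 2 ^ m * ∑ i, ‖x i - x' i‖
        + ∑ d ∈ Finset.range m, 2 * α₁ / 2 ^ m * ∑ i, ‖x i - x' i‖ :=
        (abs_add_le _ _).trans (add_le_add h1
          ((Finset.abs_sum_le_sum_abs _ _).trans (Finset.sum_le_sum h2)))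
    _ = _ := by
        rw [Finset.sum_const, Finset.card_range, nsmul_eq_mul, ← Finset.mul_sum]
        ring

lemma memLp_estimator (hα₁ : 0 ≤ α₁) (hf₁ : ∀ x y, |f x - f (x + y)| ≤ α₁ * ‖y‖)
    {q : Fin (2 ^ m) → EuclideanSpace ℝ (Fin K) × ℝ} (hq : IsHalvable q)
    (hκ : ∀ i, MemLp (fun x => x) 2 (κ i)) :
    MemLp (fun x => estimator m f x (blocksOf q) (blocksOf' q)) 2 (Measure.pi κ) :=
  memLp_of_abs_sub_le κ (fun _ => 0) (fun i => memLp_sub_const (hκ i) 0) _ _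
    (abs_estimator_sub_le hα₁ hf₁ hq)

lemma variance_estimator_le (hα₁ : 0 ≤ α₁) (hf₁ : ∀ x y, |f x - f (x + y)| ≤ α₁ * ‖y‖)
    {V : ℝ} {q : Fin (2 ^ m) → EuclideanSpace ℝ (Fin K) × ℝ} (hq : IsHalvable q)
    (hκ : ∀ i, MemLp (fun x => x) 2 (κ i))
    (hV : ∀ i, ∫ x, ‖x - ∫ x', x' ∂(κ i)‖ ^ 2 ∂(κ i) ≤ V) :
    Var[fun x => estimator m f x (blocksOf q) (blocksOf' q); Measure.pi κ]
      ≤ V * ((2 * m + 1) * α₁) ^ 2 / 2 ^ m := by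
  refine (variance_pi_le (2 ^ m) κ (fun i => ∫ x', x' ∂(κ i))
    (fun i => memLp_sub_const (hκ i) _) hV _ _ (abs_estimator_sub_le hα₁ hf₁ hq)).trans_eq ?_
  rw [Finset.sum_const, Finset.card_univ, Fintype.card_fin, nsmul_eq_mul]
  push_cast
  field_simp

/-- Adding and subtracting the reference values for the laws κ_i splits each level into its bias and
a difference of consecutive `sizeMean`s. These differences telescope from block size 2^m down to
size 1, where they cancel the plain mean of f. -/
lemma integral_estimator_eq (hα₁ : 0 ≤ α₁) (hf₁ : ∀ x y, |f x - f (x + y)| ≤ α₁ * ‖y‖)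
    {q : Fin (2 ^ m) → EuclideanSpace ℝ (Fin K) × ℝ} (hq : IsHalvable q)
    (hκ : ∀ i, MemLp (fun x => x) 2 (κ i)) :
    ∫ x, estimator m f x (blocksOf q) (blocksOf' q) ∂(Measure.pi κ)
      = ∑ d ∈ Finset.range m, levelBias κ f q d
        + (1 / 2 ^ m : ℝ) * ∑ i, sizeMean (2 ^ m) f (κ i) (2 ^ m) := by
  have hfc := continuous_of_abs_sub_le hf₁
  have hfi : ∀ i, Integrable (fun x : Fin (2 ^ m) → EuclideanSpace ℝ (Fin J) => f (x i))
      (Measure.pi κ) := fun i => by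
    have := (memLp_comp_blockMean hα₁ hf₁ κ hκ {i}).integrable one_le_two
    simpa [blockMean] using this
  have hdi : ∀ d ∈ Finset.range m, Integrable (fun x => (1 / 2 ^ d : ℝ) *
      ∑ u : Fin d → Bool, blockDefect f q u x) (Measure.pi κ) := fun d hd =>
    (integrable_finsetSum _ fun u _ => (memLp_blockDefect hα₁ hf₁ hq hκ
      (Finset.mem_range.1 hd) u).integrable one_le_two).const_mul _
  have h1 : ∫ x, estimator m f x (blocksOf q) (blocksOf' q) ∂(Measure.pi κ)
      = (1 / 2 ^ m : ℝ) * ∑ i, ∫ x, f x ∂(κ i) + ∑ d ∈ Finset.range m, (1 / 2 ^ d : ℝ) *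
        ∑ u : Fin d → Bool, ∫ x, blockDefect f q u x ∂(Measure.pi κ) := by
    simp only [estimator_blocksOf f hq]
    rw [integral_add ((integrable_finsetSum _ fun i _ => hfi i).const_mul _)
      (integrable_finsetSum _ hdi), integral_const_mul, integral_finsetSum _ fun i _ => hfi i,
      integral_finsetSum _ hdi]
    congr 1
    · congr 1
      exact Finset.sum_congr rfl fun i _ => integral_comp_eval hfc.aestronglyMeasurable
    · refine Finset.sum_congr rfl fun d hd => ?_
      rw [integral_const_mul, integral_finsetSum _ fun u _ => (memLp_blockDefect hα₁ hf₁ hq hκ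
        (Finset.mem_range.1 hd) u).integrable one_le_two]
  have h2 : ∀ d ∈ Finset.range m, levelBias κ f q d = (1 / 2 ^ d : ℝ) *
      ∑ u : Fin d → Bool, ∫ x, blockDefect f q u x ∂(Measure.pi κ)
      - (1 / 2 ^ m : ℝ) * ∑ i, (sizeMean (2 ^ m) f (κ i) (2 ^ (m - d))
        - sizeMean (2 ^ m) f (κ i) (2 ^ (m - (d + 1)))) := by
    intro d hd
    rw [Finset.mem_range] at hd
    have h3 : ∀ (u : Fin d → Bool) (i), ∫ x, blockDefect f q u x ∂(Measure.pi fun _ => κ i)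
        = sizeMean (2 ^ m) f (κ i) (2 ^ (m - d))
          - sizeMean (2 ^ m) f (κ i) (2 ^ (m - (d + 1))) := fun u i => by
      have := (hq.2.isSplit hd u).integral_splitDefect hα₁ hf₁ (κ i) (hκ i)
      rw [hq.2.card_eq hd.le, hq.2.card' d hd] at this
      exact this
    -- The uniform mean over all indices is the mean over blocks of the means inside blocks, because
    -- 2^d·2^(m-d) = 2^m.
    rw [levelBias, ← hq.2.sum_blocks hd.le, ← Finset.mul_sum]
    simp only [h3, Finset.sum_sub_distrib (f := fun _ => ∫ x, blockDefect f q _ x ∂(Measure.pi κ)),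
      Finset.sum_const, nsmul_eq_mul, hq.2.card_eq hd.le]
    rw [Finset.sum_sub_distrib, ← Finset.mul_sum, ← pow_sub_mul_pow (2 : ℝ) hd.le]
    push_cast
    field_simp
  have h4 : ∑ d ∈ Finset.range m, (1 / 2 ^ m : ℝ) * ∑ i, (sizeMean (2 ^ m) f (κ i) (2 ^ (m - d))
        - sizeMean (2 ^ m) f (κ i) (2 ^ (m - (d + 1))))
      = (1 / 2 ^ m : ℝ) * ∑ i, (sizeMean (2 ^ m) f (κ i) (2 ^ m) - ∫ x, f x ∂(κ i)) := by
    rw [← Finset.mul_sum, Finset.sum_comm]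
    congr 1
    refine Finset.sum_congr rfl fun i _ => ?_
    rw [Finset.sum_range_sub' (fun d => sizeMean (2 ^ m) f (κ i) (2 ^ (m - d)))]
    simp only [Nat.sub_zero, Nat.sub_self, pow_zero]
    rw [sizeMean_one (by positivity) hf₁]
  rw [h1, Finset.sum_congr rfl h2, Finset.sum_sub_distrib, h4, Finset.sum_sub_distrib]
  ring

end Conditional

/-! ### Conditional laws, couplings and the outer Monte Carlo error -/

section Law

variable {J K : ℕ} (ρ : Measure (EuclideanSpace ℝ (Fin J) × EuclideanSpace ℝ (Fin K)))
  [IsProbabilityMeasure ρ]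

lemma stronglyMeasurable_condMean : StronglyMeasurable (condMean ρ) :=
  stronglyMeasurable_id.integral_kernel (κ := condLaw ρ)

variable {ρ}

lemma memLp_condLaw_of_condVar_le {V : ℝ≥0} {y : EuclideanSpace ℝ (Fin K)}
    (h : condVar ρ y ≤ V) : MemLp (fun x => x) 2 (condLaw ρ y) ∧
      ∫ x, ‖x - ∫ x', x' ∂(condLaw ρ y)‖ ^ 2 ∂(condLaw ρ y) ≤ V := by
  change ∫⁻ x, ‖x - condMean ρ y‖ₑ ^ 2 ∂(condLaw ρ y) ≤ V at h
  change _ ∧ ∫ x, ‖x - condMean ρ y‖ ^ 2 ∂(condLaw ρ y) ≤ V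
  have he : ∀ x : EuclideanSpace ℝ (Fin J), ENNReal.ofReal (‖x - condMean ρ y‖ ^ 2)
      = ‖x - condMean ρ y‖ₑ ^ 2 := fun x => by
    rw [ENNReal.ofReal_pow (norm_nonneg _), ofReal_norm]
  have hm : AEStronglyMeasurable (fun x => x - condMean ρ y) (condLaw ρ y) := by fun_prop
  have hint : Integrable (fun x => ‖x - condMean ρ y‖ ^ 2) (condLaw ρ y) := by
    refine ⟨hm.norm.pow 2, ?_⟩
    rw [hasFiniteIntegral_iff_ofReal (ae_of_all _ fun x => by positivity)]
    simp only [he]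
    exact h.trans_lt ENNReal.coe_lt_top
  have hL := (memLp_two_iff_integrable_sq_norm hm).2 hint
  refine ⟨?_, ?_⟩
  · refine (hL.add (memLp_const (condMean ρ y))).ae_eq (ae_of_all _ fun x => ?_)
    simp
  · rw [← ENNReal.ofReal_le_ofReal_iff V.coe_nonneg, ofReal_integral_eq_lintegral_ofReal hint
      (ae_of_all _ fun x => by positivity)]
    simp only [he]
    exact h.trans (by simp)

/-- The mean of the coupled difference is the difference of the means. In this way Lipschitz
dependence on 𝒯(y) passes from the conditional laws to the conditional means. -/
lemma norm_integral_sub_le_of_coupling {E : Type*} [NormedAddCommGroup E] [NormedSpace ℝ E]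
    [MeasurableSpace E] [BorelSpace E] [SecondCountableTopology E] {μ ν : Measure E}
    [IsProbabilityMeasure μ] [IsProbabilityMeasure ν]
    (hμ : MemLp (fun x => x) 2 μ) (hν : MemLp (fun x => x) 2 ν) {δ : ℝ}
    (h : ∃ γ : Measure (E × E), γ.fst = μ ∧ γ.snd = ν ∧ ∀ᵐ p ∂γ, ‖p.1 - p.2‖ ≤ δ) :
    ‖∫ x, x ∂μ - ∫ x, x ∂ν‖ ≤ δ := by
  obtain ⟨γ, h1, h2, h3⟩ := h
  have mp1 : MeasurePreserving Prod.fst γ μ := ⟨measurable_fst, h1⟩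
  have mp2 : MeasurePreserving Prod.snd γ ν := ⟨measurable_snd, h2⟩
  have hprob : IsProbabilityMeasure γ := ⟨by rw [← Measure.fst_univ, h1]; exact measure_univ⟩
  have hint1 : Integrable (fun p : E × E => p.1) γ :=
    (hμ.comp_measurePreserving mp1).integrable one_le_two
  have hint2 : Integrable (fun p : E × E => p.2) γ :=
    (hν.comp_measurePreserving mp2).integrable one_le_two
  rw [← integral_comp_of_measurePreserving mp1 (φ := fun x => x) hμ.1,
    ← integral_comp_of_measurePreserving mp2 (φ := fun x => x) hν.1, ← integral_sub hint1 hint2]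
  exact (norm_integral_le_of_norm_le_const h3).trans_eq (by simp)

lemma norm_coordMap_sub_le {T : Fin K → ℝ → ℝ} (hT : ∀ k s, T k s ∈ Set.Icc (0 : ℝ) 1)
    (y y' : EuclideanSpace ℝ (Fin K)) : ‖coordMap T y - coordMap T y'‖ ≤ √K := by
  rw [EuclideanSpace.norm_eq]
  refine Real.sqrt_le_sqrt ?_
  calc _ ≤ ∑ k : Fin K, (1 : ℝ) := Finset.sum_le_sum fun k _ => by
        have h1 := hT k (y k)
        have h2 := hT k (y' k)
        change ‖T k (y k) - T k (y' k)‖ ^ 2 ≤ 1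
        rw [Real.norm_eq_abs]
        refine pow_le_one₀ (abs_nonneg _) (abs_le.2 ⟨?_, ?_⟩) <;>
          linarith [h1.1, h1.2, h2.1, h2.2]
    _ = K := by simp

/-- The coupling of the conditional laws given `y` and `y'`. -/
def HasCoupling (ρ : Measure (EuclideanSpace ℝ (Fin J) × EuclideanSpace ℝ (Fin K)))
    [IsProbabilityMeasure ρ] (T : Fin K → ℝ → ℝ) (β : ℝ) (y y' : EuclideanSpace ℝ (Fin K)) :
    Prop :=
  ∃ γ : Measure (EuclideanSpace ℝ (Fin J) × EuclideanSpace ℝ (Fin J)),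
    γ.fst = condLaw ρ y ∧ γ.snd = condLaw ρ y' ∧
      ∀ᵐ x ∂γ, ‖x.1 - x.2‖ ≤ β * ‖coordMap T y - coordMap T y'‖

/-- The hypothesis holds almost everywhere for a product law, which says nothing about a sample
paired with itself; the diagonal coupling covers i = j. -/
lemma hasCoupling_self (T : Fin K → ℝ → ℝ) (β : ℝ) (y : EuclideanSpace ℝ (Fin K)) :
    HasCoupling ρ T β y y := by
  refine ⟨(condLaw ρ y).map (fun x => (x, x)), ?_, ?_, ?_⟩
  · rw [Measure.fst, Measure.map_map measurable_fst (by fun_prop)]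
    exact Measure.map_id
  · rw [Measure.snd, Measure.map_map measurable_snd (by fun_prop)]
    exact Measure.map_id
  · refine (ae_map_iff (by fun_prop) ?_).2 (ae_of_all _ fun x => by simp)
    exact measurableSet_le (by fun_prop) (by fun_prop)

lemma ae_hasCoupling {T : Fin K → ℝ → ℝ} {β : ℝ}
    (h : ∀ᵐ y ∂(ρ.snd.prod ρ.snd), HasCoupling ρ T β y.1 y.2) (ν : Measure ℝ)
    [IsProbabilityMeasure ν] (N : ℕ) :
    ∀ᵐ q ∂(Measure.pi fun _ : Fin N => ρ.snd.prod ν), ∀ i j,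
      HasCoupling ρ T β (q i).1 (q j).1 := by
  refine ae_all_iff.2 fun i => ae_all_iff.2 fun j => ?_
  by_cases hij : i = j
  · subst hij
    exact ae_of_all _ fun q => hasCoupling_self T β _
  · have mp : MeasurePreserving (Prod.fst : EuclideanSpace ℝ (Fin K) × ℝ → _)
        (ρ.snd.prod ν) ρ.snd := ⟨measurable_fst, by rw [Measure.map_fst_prod]; simp⟩
    exact ((mp.prod mp).comp (measurePreserving_eval_pair
      (fun _ : Fin N => ρ.snd.prod ν) hij)).quasiMeasurePreserving.ae h

lemma ae_outer {p : EuclideanSpace ℝ (Fin K) → Prop} (h : ∀ᵐ y ∂ρ.snd, p y) (ν : Measure ℝ)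
    [IsProbabilityMeasure ν] (N : ℕ) :
    ∀ᵐ q ∂(Measure.pi fun _ : Fin N => ρ.snd.prod ν), ∀ i, p (q i).1 := by
  refine ae_all_iff.2 fun i => ?_
  have mp : MeasurePreserving (Prod.fst : EuclideanSpace ℝ (Fin K) × ℝ → _)
      (ρ.snd.prod ν) ρ.snd := ⟨measurable_fst, by rw [Measure.map_fst_prod]; simp⟩
  exact (mp.comp (measurePreserving_eval (fun _ : Fin N => ρ.snd.prod ν) i)).quasiMeasurePreserving.ae h

variable {f : EuclideanSpace ℝ (Fin J) → ℝ} {α₁ β : ℝ} {T : Fin K → ℝ → ℝ} {V : ℝ≥0}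

/-- 𝒯 takes values in a cube of diameter √K, so almost every f(𝔼[X | Y = y]) is within α₁β√K of its
value at one typical y₀. Hence the integrand is bounded, with no moment assumption on Y; comparing
with the mean through y₀ doubles the constant. -/
lemma abs_condMean_sub_nestedExp_le (hvar : ∀ᵐ y ∂ρ.snd, condVar ρ y ≤ V) (hα₁ : 0 ≤ α₁)
    (hβ : 0 ≤ β) (hf₁ : ∀ x y, |f x - f (x + y)| ≤ α₁ * ‖y‖)
    (hT : ∀ k s, T k s ∈ Set.Icc (0 : ℝ) 1)
    (h : ∀ᵐ y ∂(ρ.snd.prod ρ.snd), HasCoupling ρ T β y.1 y.2) :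
    Integrable (fun y => f (condMean ρ y)) ρ.snd ∧
      ∀ᵐ y ∂ρ.snd, |f (condMean ρ y) - nestedExp ρ f| ≤ 2 * (α₁ * (β * √K)) := by
  have hm : AEStronglyMeasurable (fun y => f (condMean ρ y)) ρ.snd :=
    ((continuous_of_abs_sub_le hf₁).comp_stronglyMeasurable
      (stronglyMeasurable_condMean ρ)).aestronglyMeasurable
  obtain ⟨y₀, hy₀, hV₀⟩ := ((Measure.ae_ae_of_ae_prod h).and hvar).exists
  have hb : ∀ᵐ y ∂ρ.snd, |f (condMean ρ y) - f (condMean ρ y₀)| ≤ α₁ * (β * √K) := by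
    filter_upwards [hy₀, hvar] with y hy hV
    have h1 := norm_integral_sub_le_of_coupling (memLp_condLaw_of_condVar_le hV₀).1
      (memLp_condLaw_of_condVar_le hV).1 hy
    change ‖condMean ρ y₀ - condMean ρ y‖ ≤ _ at h1
    have h2 := hf₁ (condMean ρ y) (condMean ρ y₀ - condMean ρ y)
    rw [add_sub_cancel] at h2
    refine h2.trans (mul_le_mul_of_nonneg_left (h1.trans ?_) hα₁)
    exact mul_le_mul_of_nonneg_left (norm_coordMap_sub_le hT _ _) hβ
  have hi0 : Integrable (fun y => f (condMean ρ y) - f (condMean ρ y₀)) ρ.snd :=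
    Integrable.of_bound (hm.sub aestronglyMeasurable_const) _ hb
  have hi : Integrable (fun y => f (condMean ρ y)) ρ.snd := by
    refine (hi0.add (integrable_const (f (condMean ρ y₀)))).congr (ae_of_all _ fun y => ?_)
    simp
  refine ⟨hi, ?_⟩
  have h3 : |nestedExp ρ f - f (condMean ρ y₀)| ≤ α₁ * (β * √K) := by
    have h4 : nestedExp ρ f - f (condMean ρ y₀)
        = ∫ y, (f (condMean ρ y) - f (condMean ρ y₀)) ∂ρ.snd := by
      rw [integral_sub hi (integrable_const _), integral_const, probReal_univ, one_smul]
      rfl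
    rw [h4, ← Real.norm_eq_abs]
    exact (norm_integral_le_of_norm_le_const hb).trans_eq (by simp)
  filter_upwards [hb] with y hy
  have := abs_sub_le (f (condMean ρ y)) (f (condMean ρ y₀)) (nestedExp ρ f)
  rw [abs_sub_comm (f (condMean ρ y₀))] at this
  linarith

/-- The mean squared error of the sample mean of `f(𝔼[X | Y])`. -/
lemma lintegral_sq_mean_condMean_le (hvar : ∀ᵐ y ∂ρ.snd, condVar ρ y ≤ V) (hα₁ : 0 ≤ α₁)
    (hβ : 0 ≤ β) (hf₁ : ∀ x y, |f x - f (x + y)| ≤ α₁ * ‖y‖)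
    (hT : ∀ k s, T k s ∈ Set.Icc (0 : ℝ) 1)
    (h : ∀ᵐ y ∂(ρ.snd.prod ρ.snd), HasCoupling ρ T β y.1 y.2) (ν : Measure ℝ)
    [IsProbabilityMeasure ν] {N : ℕ} (hN : 0 < N) :
    ∫⁻ q, ENNReal.ofReal (((1 / N : ℝ) * ∑ i, (f (condMean ρ (q i).1) - nestedExp ρ f)) ^ 2)
        ∂(Measure.pi fun _ : Fin N => ρ.snd.prod ν)
      ≤ ENNReal.ofReal ((2 * (α₁ * (β * √K))) ^ 2 / N) := by
  obtain ⟨hi, hb⟩ := abs_condMean_sub_nestedExp_le hvar hα₁ hβ hf₁ hT h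
  set M := 2 * (α₁ * (β * √K)) with hM
  have hN' : (0 : ℝ) < N := by exact_mod_cast hN
  have mp : MeasurePreserving (Prod.fst : EuclideanSpace ℝ (Fin K) × ℝ → _)
      (ρ.snd.prod ν) ρ.snd := ⟨measurable_fst, by rw [Measure.map_fst_prod]; simp⟩
  set v : EuclideanSpace ℝ (Fin K) × ℝ → ℝ := fun p =>
    (1 / N : ℝ) * (f (condMean ρ p.1) - nestedExp ρ f) with hv
  have hvm : AEStronglyMeasurable v (ρ.snd.prod ν) := by
    have : StronglyMeasurable (fun p : EuclideanSpace ℝ (Fin K) × ℝ => f (condMean ρ p.1)) :=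
      (continuous_of_abs_sub_le hf₁).comp_stronglyMeasurable
        ((stronglyMeasurable_condMean ρ).comp_measurable measurable_fst)
    exact ((this.sub stronglyMeasurable_const).const_mul _).aestronglyMeasurable
  have hvb : ∀ᵐ p ∂(ρ.snd.prod ν), ‖v p‖ ≤ (1 / N : ℝ) * M := by
    filter_upwards [mp.quasiMeasurePreserving.ae hb] with p hp
    rw [hv, norm_mul, Real.norm_eq_abs, Real.norm_eq_abs,
      abs_of_nonneg (by positivity : (0 : ℝ) ≤ 1 / N)]
    gcongr
  have hvL : MemLp v 2 (ρ.snd.prod ν) := MemLp.of_bound hvm _ hvb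
  have hv0 : ∫ p, v p ∂(ρ.snd.prod ν) = 0 := by
    have h1 : ∫ p, v p ∂(ρ.snd.prod ν)
        = ∫ y, (1 / N : ℝ) * (f (condMean ρ y) - nestedExp ρ f) ∂ρ.snd :=
      integral_comp_of_measurePreserving mp
        (φ := fun y => (1 / N : ℝ) * (f (condMean ρ y) - nestedExp ρ f))
        ((hi.sub (integrable_const _)).const_mul _).1
    rw [h1, integral_const_mul, integral_sub hi (integrable_const _), integral_const,
      probReal_univ, one_smul]
    rw [nestedExp, sub_self, mul_zero]
  have h2 := integral_norm_sq_sum_pi_le (fun _ : Fin N => ρ.snd.prod ν) (fun _ => v) (fun _ => hvL)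
  have h3 : ∫ p, ‖v p‖ ^ 2 ∂(ρ.snd.prod ν) ≤ (1 / N : ℝ) ^ 2 * M ^ 2 := by
    calc _ ≤ ∫ _, (1 / N : ℝ) ^ 2 * M ^ 2 ∂(ρ.snd.prod ν) := by
          refine integral_mono_ae hvL.norm.integrable_sq (integrable_const _) ?_
          filter_upwards [hvb] with p hp
          rw [← mul_pow]
          exact pow_le_pow_left₀ (norm_nonneg _) hp 2
      _ = _ := by simp
  have hsumL : MemLp (fun q : Fin N → EuclideanSpace ℝ (Fin K) × ℝ => ∑ i, v (q i)) 2
      (Measure.pi fun _ : Fin N => ρ.snd.prod ν) := memLp_finsetSum _ fun i _ =>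
    hvL.comp_measurePreserving (measurePreserving_eval (fun _ : Fin N => ρ.snd.prod ν) i)
  calc _ = ∫⁻ q, ENNReal.ofReal (‖∑ i, v (q i)‖ ^ 2)
        ∂(Measure.pi fun _ : Fin N => ρ.snd.prod ν) := by
        refine lintegral_congr fun q => ?_
        rw [Real.norm_eq_abs, sq_abs, ← Finset.mul_sum]
    _ = ENNReal.ofReal (∫ q, ‖∑ i, v (q i)‖ ^ 2
        ∂(Measure.pi fun _ : Fin N => ρ.snd.prod ν)) :=
        (ofReal_integral_eq_lintegral_ofReal hsumL.norm.integrable_sq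
          (ae_of_all _ fun q => by positivity)).symm
    _ ≤ _ := by
        refine ENNReal.ofReal_le_ofReal (h2.trans ?_)
        simp only [hv0, Finset.sum_const_zero, norm_zero, Finset.sum_const, Finset.card_univ,
          Fintype.card_fin, nsmul_eq_mul]
        calc _ ≤ N * ((1 / N : ℝ) ^ 2 * M ^ 2) + 0 ^ 2 := by gcongr
          _ = M ^ 2 / N := by field_simp; ring

end Law

/-! ### Assembling the conditional error -/

section Assembly

variable {J K m : ℕ} [NeZero K]

lemma measurable_estimator {f : EuclideanSpace ℝ (Fin J) → ℝ} (hf : Continuous f) :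
    Measurable (fun p : (Fin (2 ^ m) → EuclideanSpace ℝ (Fin J)) ×
      (Fin (2 ^ m) → EuclideanSpace ℝ (Fin K) × ℝ) =>
        estimator m f p.1 (blocksOf p.2) (blocksOf' p.2)) := by
  have hc : ∀ B B' : (d : ℕ) → (Fin d → Bool) → Finset (Fin (2 ^ m)),
      Continuous fun x => estimator m f x B B' := fun B B' => by
    unfold estimator levelAverage
    fun_prop
  exact measurable_prod_pattern
    (fun r x => estimator m f x (blocks m r).1 (blocks m r).2) fun r => (hc _ _).measurable

lemma measurableSet_isHalvable : MeasurableSet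
    {q : Fin (2 ^ m) → EuclideanSpace ℝ (Fin K) × ℝ | IsHalvable q} := by
  have h : {q : Fin (2 ^ m) → EuclideanSpace ℝ (Fin K) × ℝ | IsHalvable q}
      = {q | TieFree (fun i => (q i).1) (fun i => (q i).2)} ∩ pattern ⁻¹'
        {r | ∃ y t, Precedes y t = r ∧ IsHalving m y t (blocks m r).1 (blocks m r).2} := by
    ext q
    refine and_congr_right fun _ => ⟨fun h => ⟨_, _, rfl, h⟩, ?_⟩
    rintro ⟨y, t, h1, h2⟩
    exact h2.congr h1
  rw [h]
  exact measurableSet_tieFree.inter (measurableSet_blocks _)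

/-- Without ties the halving is unique at all levels that enter the estimator. Blocks given without
any measurability can thus be replaced by the chosen ones. -/
lemma estimator_eq_of_isHalving (f : EuclideanSpace ℝ (Fin J) → ℝ)
    {q : Fin (2 ^ m) → EuclideanSpace ℝ (Fin K) × ℝ}
    (ht : TieFree (fun i => (q i).1) (fun i => (q i).2))
    {B B' : (d : ℕ) → (Fin d → Bool) → Finset (Fin (2 ^ m))}
    (h : IsHalving m (fun i => (q i).1) (fun i => (q i).2) B B')
    (x : Fin (2 ^ m) → EuclideanSpace ℝ (Fin J)) :
    estimator m f x B B' = estimator m f x (blocksOf q) (blocksOf' q) := by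
  have hq := isHalving_blocksOf h
  rw [h.estimator_eq, hq.estimator_eq]
  congr 1
  refine Finset.sum_congr rfl fun d hd => ?_
  rw [Finset.mem_range] at hd
  congr 1
  refine Finset.sum_congr rfl fun u _ => ?_
  have h1 := h.eq ht hq hd.le u
  obtain ⟨h2, h3⟩ := h.index_halves_eq hq hd h1
  rw [h1, h2, h3]

/-- As m − d ≥ (m − d)/K, the exponent d/K + (m − d) is at least m/K; rounding d/K down loses at
most 1, hence the factor 2. -/
lemma half_pow_div_le (K : ℕ) [NeZero K] {d m : ℕ} (hd : d ≤ m) :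
    (1 / 2 : ℝ) ^ (d / K) / 2 ^ (m - d) ≤ 2 / (2 ^ m : ℝ) ^ (1 / K : ℝ) := by
  have hK : (1 : ℝ) ≤ K := by exact_mod_cast NeZero.one_le
  have hK0 : (0 : ℝ) < K := by linarith
  have h1 : (d : ℝ) ≤ K * (((d / K : ℕ) : ℝ) + 1) := by
    have := Nat.lt_mul_div_succ d (NeZero.pos K)
    exact_mod_cast this.le
  have h2 : (m : ℝ) / K ≤ ((d / K : ℕ) : ℝ) + ((m - d : ℕ) : ℝ) + 1 := by
    rw [div_le_iff₀ hK0, Nat.cast_sub hd]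
    have : (0 : ℝ) ≤ (m : ℝ) - d := sub_nonneg.2 (by exact_mod_cast hd)
    nlinarith
  have h3 : ((2 ^ m : ℝ)) ^ (1 / K : ℝ) ≤ 2 ^ (d / K) * 2 ^ (m - d) * 2 := by
    rw [← Real.rpow_natCast 2 m, ← Real.rpow_mul (by norm_num), mul_one_div]
    calc (2 : ℝ) ^ ((m : ℝ) / K) ≤ 2 ^ (((d / K : ℕ) : ℝ) + ((m - d : ℕ) : ℝ) + 1) :=
          Real.rpow_le_rpow_of_exponent_le (by norm_num) h2
      _ = _ := by
          rw [Real.rpow_add (by norm_num), Real.rpow_add (by norm_num), Real.rpow_natCast,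
            Real.rpow_natCast, Real.rpow_one]
  rw [le_div_iff₀ (by positivity), one_div_pow, div_div, one_div_mul_eq_div,
    div_le_iff₀ (by positivity)]
  linarith

/-- The conditional mean squared error of the estimator given the outer samples. -/
lemma integral_sq_sub_estimator_le {f : EuclideanSpace ℝ (Fin J) → ℝ} {α₁ α₂ β V I : ℝ}
    (hα₁ : 0 ≤ α₁) (hα₂ : 0 ≤ α₂) (hβ : 0 ≤ β)
    (hf₁ : ∀ x y, |f x - f (x + y)| ≤ α₁ * ‖y‖)
    (hf₂ : ∀ x y y', |f x - f (x + y) - f (x + y') + f (x + y + y')| ≤ α₂ * ‖y‖ * ‖y'‖)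
    {T : Fin K → ℝ → ℝ} (hT : ∀ k s, T k s ∈ Set.Icc (0 : ℝ) 1) (hmono : ∀ k, Monotone (T k))
    {q : Fin (2 ^ m) → EuclideanSpace ℝ (Fin K) × ℝ} (hq : IsHalvable q)
    {κ : Fin (2 ^ m) → Measure (EuclideanSpace ℝ (Fin J))} [∀ i, IsProbabilityMeasure (κ i)]
    {g : EuclideanSpace ℝ (Fin K) → EuclideanSpace ℝ (Fin J)}
    (hg : ∀ i, ∫ x, x ∂(κ i) = g (q i).1) (hκ : ∀ i, MemLp (fun x => x) 2 (κ i))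
    (hV : ∀ i, ∫ x, ‖x - ∫ x', x' ∂(κ i)‖ ^ 2 ∂(κ i) ≤ V)
    (hγ : ∀ i j, ∃ γ : Measure (EuclideanSpace ℝ (Fin J) × EuclideanSpace ℝ (Fin J)),
      γ.fst = κ i ∧ γ.snd = κ j ∧
        ∀ᵐ p ∂γ, ‖p.1 - p.2‖ ≤ β * ‖coordMap T (q i).1 - coordMap T (q j).1‖) :
    Integrable (fun x => (I - estimator m f x (blocksOf q) (blocksOf' q)) ^ 2) (Measure.pi κ) ∧
    ∫ x, (I - estimator m f x (blocksOf q) (blocksOf' q)) ^ 2 ∂(Measure.pi κ)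
      ≤ (V * ((2 * m + 1) * α₁) ^ 2 / 2 ^ m + 3 * (α₁ ^ 2 * V / 2 ^ m)
          + 3 * m * (α₂ ^ 2 * (8 * V + β ^ 2 * K)) * ∑ d ∈ Finset.range m,
            β ^ 2 * (K * (1 / 2) ^ (d / K)) / 2 ^ (m - d))
        + (3 * m * (α₂ ^ 2 * (8 * V + β ^ 2 * K))) * ∑ d ∈ Finset.range m,
            (1 / 2 ^ d : ℝ) * ∑ u : Fin d → Bool, ‖halfDiff g q u‖ ^ 2
        + 3 * ((1 / (2 ^ m : ℕ) : ℝ) * ∑ i, (f (g (q i).1) - I)) ^ 2 := by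
  have hL := memLp_estimator hα₁ hf₁ hq hκ
  have hL' : MemLp (fun x => estimator m f x (blocksOf q) (blocksOf' q) - I) 2 (Measure.pi κ) :=
    hL.sub (memLp_const I)
  have hsymm : ∀ x, (I - estimator m f x (blocksOf q) (blocksOf' q)) ^ 2
      = (estimator m f x (blocksOf q) (blocksOf' q) - I) ^ 2 := fun x => by ring
  simp only [hsymm]
  refine ⟨hL'.integrable_sq, ?_⟩
  have h1 := variance_eq_sub hL'
  rw [variance_sub_const hL.1] at h1
  have h2 : ∫ x, (estimator m f x (blocksOf q) (blocksOf' q) - I) ∂(Measure.pi κ)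
      = ∫ x, estimator m f x (blocksOf q) (blocksOf' q) ∂(Measure.pi κ) - I := by
    rw [integral_sub (hL.integrable one_le_two) (integrable_const _), integral_const,
      probReal_univ, one_smul]
  have h3 := variance_estimator_le hα₁ hf₁ hq hκ hV
  set bias := ∑ d ∈ Finset.range m, levelBias κ f q d with hbias
  set Φ := (1 / (2 ^ m : ℕ) : ℝ) * ∑ i, (sizeMean (2 ^ m) f (κ i) (2 ^ m) - f (g (q i).1)) with hΦ
  set A := (1 / (2 ^ m : ℕ) : ℝ) * ∑ i, (f (g (q i).1) - I) with hA
  have h4 : ∫ x, estimator m f x (blocksOf q) (blocksOf' q) ∂(Measure.pi κ) - I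
      = bias + Φ + A := by
    rw [integral_estimator_eq hα₁ hf₁ hq hκ, hΦ, hA, Finset.sum_sub_distrib,
      Finset.sum_sub_distrib, Finset.sum_const, Finset.card_univ, Fintype.card_fin, nsmul_eq_mul]
    push_cast
    field_simp
    ring
  have h5 : Φ ^ 2 ≤ α₁ ^ 2 * V / 2 ^ m := by
    refine (sq_mean_le Finset.univ (n := (2 ^ m : ℕ)) (by simp)
      (M := fun _ => α₁ ^ 2 * V / (2 ^ m : ℕ)) fun i _ => ?_).trans_eq ?_
    · rw [← hg i]
      exact sq_sizeMean_sub_le (by positivity) hα₁ hf₁ (κ i) (hκ i) (hV i)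
    · rw [Finset.sum_const, Finset.card_univ, Fintype.card_fin, nsmul_eq_mul]
      push_cast
      field_simp
  have h6 : bias ^ 2 ≤ m * ∑ d ∈ Finset.range m, (α₂ ^ 2 * (8 * V + β ^ 2 * K) *
      (β ^ 2 * (K * (1 / 2) ^ (d / K)) / 2 ^ (m - d)
        + (1 / 2 ^ d : ℝ) * ∑ u : Fin d → Bool, ‖halfDiff g q u‖ ^ 2)) := by
    -- Cauchy–Schwarz over the m levels: this m and the m summands it multiplies produce the squared
    -- logarithm in the bias.
    refine (sq_sum_le_card_mul_sum_sq).trans ?_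
    rw [Finset.card_range]
    gcongr with d hd
    exact sq_levelBias_le hα₁ hα₂ hf₁ hf₂ hT hmono hβ hq hg hκ hV hγ (Finset.mem_range.1 hd)
  rw [← Finset.mul_sum, Finset.sum_add_distrib] at h6
  -- The three parts are the coupling bias, the bias of f at a mean of N samples, and the outer
  -- Monte Carlo error.
  have h7 : (bias + Φ + A) ^ 2 ≤ 3 * (bias ^ 2 + Φ ^ 2 + A ^ 2) := by
    nlinarith [sq_nonneg (bias - Φ), sq_nonneg (bias - A), sq_nonneg (Φ - A)]
  simp only [Pi.pow_apply] at h1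
  rw [h2, h4] at h1
  linarith

end Assembly

end NestedExpectation

/-! ### The rate of convergence -/

open NestedExpectation in
theorem theorem1 {J K : ℕ} [NeZero K]
    -- the joint law of `(X, Y)`
    (ρ : Measure (EuclideanSpace ℝ (Fin J) × EuclideanSpace ℝ (Fin K))) [IsProbabilityMeasure ρ]
    (f : EuclideanSpace ℝ (Fin J) → ℝ)
    (hvar : ∃ V : ℝ≥0, ∀ᵐ y ∂ρ.snd, NestedExpectation.condVar ρ y ≤ V)
    (α₁ α₂ β : ℝ) (hα₁ : 0 < α₁) (hα₂ : 0 < α₂) (hβ : 0 < β)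
    (hf₁ : ∀ x y, |f x - f (x + y)| ≤ α₁ * ‖y‖)
    (hf₂ : ∀ x y y', |f x - f (x + y) - f (x + y') + f (x + y + y')| ≤ α₂ * ‖y‖ * ‖y'‖)
    (T : Fin K → ℝ → ℝ) (hT : ∀ k s, T k s ∈ Set.Icc (0 : ℝ) 1) (hTmono : ∀ k, Monotone (T k))
    (hcoupling : ∀ᵐ y ∂(ρ.snd.prod ρ.snd),
      ∃ γ : Measure (EuclideanSpace ℝ (Fin J) × EuclideanSpace ℝ (Fin J)),
        γ.fst = NestedExpectation.condLaw ρ y.1 ∧ γ.snd = NestedExpectation.condLaw ρ y.2 ∧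
        ∀ᵐ x ∂γ, ‖x.1 - x.2‖ ≤
          β * ‖NestedExpectation.coordMap T y.1 - NestedExpectation.coordMap T y.2‖) :
    ∃ C : ℝ, ∀ m : ℕ, 1 ≤ m →
      ∀ (Ω : Type*) [MeasurableSpace Ω] (P : Measure Ω) [IsProbabilityMeasure P]
        -- the samples `(X^(i), Y^(i))` and the random marks `t^(i)`, of any law `ν`, that break ties
        (ν : Measure ℝ) [IsProbabilityMeasure ν]
        (X : Fin (2 ^ m) → Ω → EuclideanSpace ℝ (Fin J))
        (Y : Fin (2 ^ m) → Ω → EuclideanSpace ℝ (Fin K))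
        (t : Fin (2 ^ m) → Ω → ℝ)
        (B B' : Ω → (d : ℕ) → (Fin d → Bool) → Finset (Fin (2 ^ m))),
        (∀ i, Measurable (X i)) → (∀ i, Measurable (Y i)) → (∀ i, Measurable (t i)) →
        iIndepFun (fun i ω => ((X i ω, Y i ω), t i ω)) P →
        (∀ i, P.map (fun ω => ((X i ω, Y i ω), t i ω)) =
          ρ.prod ν) →
        -- the marks resolve all ties
        (∀ᵐ ω ∂P, ∀ i j, i ≠ j → ∀ k, Y i ω k = Y j ω k → t i ω ≠ t j ω) →
        (∀ᵐ ω ∂P, NestedExpectation.IsHalving m (fun i => Y i ω) (fun i => t i ω) (B ω) (B' ω)) →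
        ∫⁻ ω, ENNReal.ofReal ((NestedExpectation.nestedExp ρ f -
            NestedExpectation.estimator m f (fun i => X i ω) (B ω) (B' ω)) ^ 2) ∂P ≤
          ENNReal.ofReal (C * (Real.log (2 ^ m) ^ 2 / (2 ^ m : ℝ) ^ (1 / K : ℝ))) := by
  obtain ⟨V, hV⟩ := hvar
  set M := 2 * (α₁ * (β * √K)) with hM
  set C₀ := α₂ ^ 2 * (8 * V + β ^ 2 * K) with hC₀
  -- In order: the variance, with (2m + 1)² ≤ 9m²; the bias of means of N samples; the coupling
  -- bias; the outer Monte Carlo error.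
  set C₁ := 9 * V * α₁ ^ 2 + 3 * α₁ ^ 2 * V + 12 * C₀ * β ^ 2 * K + 3 * M ^ 2 with hC₁
  -- The estimate is proved with m² in place of (log 2^m)² = m²(log 2)².
  refine ⟨C₁ / Real.log 2 ^ 2, ?_⟩
  intro m hm Ω _ P _ ν _ X Y t B B' hX hY ht hind hlaw htie hhalf
  set Q : Measure (Fin (2 ^ m) → EuclideanSpace ℝ (Fin K) × ℝ) :=
    Measure.pi fun _ => ρ.snd.prod ν with hQ
  have hfc := continuous_of_abs_sub_le hf₁
  have hC₀0 : 0 ≤ C₀ := by positivity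
  -- transfer to the product space
  have hreg : ∀ᵐ q ∂Q, IsHalvable q := by
    rw [hQ, ← map_outer_samples ρ ν P hX hY ht hind hlaw]
    refine (ae_map_iff (measurable_pi_iff.2 fun i => (hY i).prodMk (ht i)).aemeasurable
      measurableSet_isHalvable).2 ?_
    filter_upwards [htie, hhalf] with ω h1 h2
    exact ⟨h1, isHalving_blocksOf h2⟩
  have hcoup : ∀ᵐ q ∂Q, ∀ i j, HasCoupling ρ T β (q i).1 (q j).1 :=
    ae_hasCoupling (ρ := ρ) hcoupling ν (2 ^ m)
  have hV' : ∀ᵐ q ∂Q, ∀ i, condVar ρ (q i).1 ≤ V := ae_outer hV ν (2 ^ m)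
  have hlip : ∀ᵐ q ∂Q, ∀ i j, ‖condMean ρ (q i).1 - condMean ρ (q j).1‖
      ≤ β * ‖coordMap T (q i).1 - coordMap T (q j).1‖ := by
    filter_upwards [hcoup, hV'] with q h1 h2 i j
    exact norm_integral_sub_le_of_coupling (memLp_condLaw_of_condVar_le (h2 i)).1
      (memLp_condLaw_of_condVar_le (h2 j)).1 (h1 i j)
  have hH : Measurable (Function.uncurry fun (x : Fin (2 ^ m) → EuclideanSpace ℝ (Fin J))
      (q : Fin (2 ^ m) → EuclideanSpace ℝ (Fin K) × ℝ) =>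
      ENNReal.ofReal ((nestedExp ρ f - estimator m f x (blocksOf q) (blocksOf' q)) ^ 2)) :=
    ((measurable_const.sub (measurable_estimator hfc)).pow_const 2).ennreal_ofReal
  have hstart : ∫⁻ ω, ENNReal.ofReal ((nestedExp ρ f -
      estimator m f (fun i => X i ω) (B ω) (B' ω)) ^ 2) ∂P
      = ∫⁻ q, ∫⁻ x, ENNReal.ofReal ((nestedExp ρ f -
        estimator m f x (blocksOf q) (blocksOf' q)) ^ 2)
          ∂(Measure.pi fun i => condLaw ρ (q i).1) ∂Q := by
    rw [← lintegral_samples ρ ν P hX hY ht hind hlaw hH]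
    refine lintegral_congr_ae ?_
    filter_upwards [htie, hhalf] with ω h1 h2
    rw [estimator_eq_of_isHalving f (q := fun i => (Y i ω, t i ω)) h1 h2]
  set a : ℝ := V * ((2 * m + 1) * α₁) ^ 2 / 2 ^ m + 3 * (α₁ ^ 2 * V / 2 ^ m)
          + 3 * m * C₀ * ∑ d ∈ Finset.range m,
            β ^ 2 * (K * (1 / 2) ^ (d / K)) / 2 ^ (m - d) with ha
  set b : ℝ := 3 * m * C₀ with hb
  have ha0 : 0 ≤ a := by positivity
  have hb0 : 0 ≤ b := by positivity
  let h : ℕ → (Fin (2 ^ m) → EuclideanSpace ℝ (Fin K) × ℝ) → ℝ := fun d q =>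
    (1 / 2 ^ d : ℝ) * ∑ u : Fin d → Bool, ‖halfDiff (condMean ρ) q u‖ ^ 2
  let A : (Fin (2 ^ m) → EuclideanSpace ℝ (Fin K) × ℝ) → ℝ := fun q =>
    ((1 / (2 ^ m : ℕ) : ℝ) * ∑ i, (f (condMean ρ (q i).1) - nestedExp ρ f)) ^ 2
  have hgm := stronglyMeasurable_condMean ρ
  have hh0 : ∀ d q, 0 ≤ h d q := fun d q => by positivity
  have hhm : ∀ d, Measurable (fun q => ENNReal.ofReal (h d q)) := fun d =>
    ((Finset.measurable_sum _ fun u _ => measurable_norm_sq_halfDiff hgm u).const_mul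
      _).ennreal_ofReal
  have hpoint : ∀ᵐ q ∂Q, ∫⁻ x, ENNReal.ofReal ((nestedExp ρ f -
        estimator m f x (blocksOf q) (blocksOf' q)) ^ 2)
          ∂(Measure.pi fun i => condLaw ρ (q i).1)
      ≤ ENNReal.ofReal a + ENNReal.ofReal b * ∑ d ∈ Finset.range m, ENNReal.ofReal (h d q)
        + ENNReal.ofReal 3 * ENNReal.ofReal (A q) := by
    filter_upwards [hreg, hcoup, hV'] with q h1 h2 h3
    obtain ⟨h4, h5⟩ := integral_sq_sub_estimator_le (I := nestedExp ρ f) hα₁.le hα₂.le hβ.le hf₁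
      hf₂ hT hTmono h1 (κ := fun i => condLaw ρ (q i).1) (g := condMean ρ) (fun i => rfl)
      (fun i => (memLp_condLaw_of_condVar_le (h3 i)).1)
      (fun i => (memLp_condLaw_of_condVar_le (h3 i)).2) h2
    rw [← ofReal_integral_eq_lintegral_ofReal h4 (ae_of_all _ fun x => sq_nonneg _)]
    refine (ENNReal.ofReal_le_ofReal h5).trans_eq ?_
    rw [← ENNReal.ofReal_sum_of_nonneg fun d _ => hh0 d q, ← ENNReal.ofReal_mul hb0,
      ← ENNReal.ofReal_mul (by norm_num), ← ENNReal.ofReal_add ha0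
        (mul_nonneg hb0 (Finset.sum_nonneg fun d _ => hh0 d q)),
      ← ENNReal.ofReal_add (add_nonneg ha0
        (mul_nonneg hb0 (Finset.sum_nonneg fun d _ => hh0 d q))) (by positivity)]
  have hA := lintegral_sq_mean_condMean_le (N := 2 ^ m) hV hα₁.le hβ.le hf₁ hT hcoupling ν
    (by positivity)
  have hh := fun d (hd : d ∈ Finset.range m) => lintegral_halfDiff_le (ρ.snd.prod ν) hreg hgm hT
    hTmono hβ.le hlip (Finset.mem_range.1 hd)
  set ε : ℝ := 1 / (2 ^ m : ℝ) ^ (1 / K : ℝ) with hε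
  have hε0 : 0 ≤ ε := by positivity
  have hεd : ∀ d ∈ Finset.range m, β ^ 2 * (K * (1 / 2) ^ (d / K)) / 2 ^ (m - d)
      ≤ 2 * β ^ 2 * K * ε := fun d hd => by
    have := half_pow_div_le K (Finset.mem_range.1 hd).le
    calc _ = β ^ 2 * K * ((1 / 2 : ℝ) ^ (d / K) / 2 ^ (m - d)) := by ring
      _ ≤ β ^ 2 * K * (2 / (2 ^ m : ℝ) ^ (1 / K : ℝ)) := by gcongr
      _ = _ := by rw [hε]; ring
  have hεm : 1 / 2 ^ m ≤ ε := by
    have h1 : (1 : ℝ) ≤ K := by exact_mod_cast NeZero.one_le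
    have h2 : (1 : ℝ) ≤ 2 ^ m := one_le_pow₀ one_le_two
    have h3 := Real.rpow_le_rpow_of_exponent_le h2 (div_le_one_of_le₀ h1 (by positivity))
    rw [Real.rpow_one] at h3
    exact one_div_le_one_div_of_le (by positivity) h3
  have htotal : a + b * ∑ d ∈ Finset.range m, β ^ 2 * (K * (1 / 2) ^ (d / K)) / 2 ^ (m - d)
      + 3 * (M ^ 2 / (2 ^ m : ℕ)) ≤ C₁ * (m ^ 2 * ε) := by
    have hm1 : (1 : ℝ) ≤ m := by exact_mod_cast hm
    have hm2 : (1 : ℝ) ≤ m ^ 2 := one_le_pow₀ hm1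
    have hm3 : (2 * m + 1 : ℝ) ^ 2 ≤ 9 * m ^ 2 := by nlinarith
    have hε1 : 1 / 2 ^ m ≤ m ^ 2 * ε := hεm.trans (le_mul_of_one_le_left hε0 hm2)
    set S := ∑ d ∈ Finset.range m, β ^ 2 * (K * (1 / 2) ^ (d / K)) / 2 ^ (m - d)
    have hS : S ≤ m * (2 * β ^ 2 * K * ε) :=
      (Finset.sum_le_sum hεd).trans_eq (by rw [Finset.sum_const, Finset.card_range, nsmul_eq_mul])
    -- S occurs twice with factor 3mC₀: inside `a` from the block radii, and again from the averaged
    -- half differences, which obey the same bound.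
    calc _ = V * α₁ ^ 2 * ((2 * m + 1 : ℝ) ^ 2 * (1 / 2 ^ m)) + 3 * α₁ ^ 2 * V * (1 / 2 ^ m)
          + 6 * m * C₀ * S + 3 * M ^ 2 * (1 / 2 ^ m) := by
          rw [ha, hb]
          push_cast
          ring
      _ ≤ V * α₁ ^ 2 * (9 * m ^ 2 * ε) + 3 * α₁ ^ 2 * V * (m ^ 2 * ε)
          + 6 * m * C₀ * (m * (2 * β ^ 2 * K * ε)) + 3 * M ^ 2 * (m ^ 2 * ε) := by
          gcongr
      _ = _ := by
          rw [hC₁]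
          ring
  rw [hstart]
  calc _ ≤ ∫⁻ q, (ENNReal.ofReal a + ENNReal.ofReal b * ∑ d ∈ Finset.range m,
          ENNReal.ofReal (h d q) + ENNReal.ofReal 3 * ENNReal.ofReal (A q)) ∂Q :=
        lintegral_mono_ae hpoint
    _ = ENNReal.ofReal a + ENNReal.ofReal b * ∑ d ∈ Finset.range m,
          ∫⁻ q, ENNReal.ofReal (h d q) ∂Q
          + ENNReal.ofReal 3 * ∫⁻ q, ENNReal.ofReal (A q) ∂Q := by
        rw [lintegral_add_left (by fun_prop), lintegral_add_left (by fun_prop),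
          lintegral_const, measure_univ, mul_one,
          lintegral_const_mul' _ _ ENNReal.ofReal_ne_top,
          lintegral_const_mul' _ _ ENNReal.ofReal_ne_top, lintegral_finsetSum _ fun d _ => hhm d]
    _ ≤ ENNReal.ofReal a + ENNReal.ofReal b * ∑ d ∈ Finset.range m,
          ENNReal.ofReal (β ^ 2 * (K * (1 / 2) ^ (d / K)) / 2 ^ (m - d))
          + ENNReal.ofReal 3 * ENNReal.ofReal (M ^ 2 / (2 ^ m : ℕ)) := by
        gcongr with d hd
        exact hh d hd
    _ = ENNReal.ofReal (a + b * ∑ d ∈ Finset.range m,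
          β ^ 2 * (K * (1 / 2) ^ (d / K)) / 2 ^ (m - d) + 3 * (M ^ 2 / (2 ^ m : ℕ))) := by
        rw [← ENNReal.ofReal_sum_of_nonneg fun d _ => by positivity, ← ENNReal.ofReal_mul hb0,
          ← ENNReal.ofReal_mul (by norm_num), ← ENNReal.ofReal_add ha0 (by positivity),
          ← ENNReal.ofReal_add (by positivity) (by positivity)]
    _ ≤ _ := by
        refine ENNReal.ofReal_le_ofReal (htotal.trans_eq ?_)
        have : Real.log 2 ≠ 0 := (Real.log_pos (by norm_num)).ne'
        rw [Real.log_pow, hε]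
        field_simp
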